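/- Let $\mathcal H_S$ be a finite-dimensional complex Hilbert space. A quantum Markov semigroup (QMS) on $\mathcal H_S$ is a norm-continuous family $(\Lambda^t)_{t\ge 0}$ of completely positive, unit-preserving linear maps on $\mathcal B(\mathcal H_S)$ with $\Lambda^0=\mathrm{id}$ and $\Lambda^{s+t}=\Lambda^s\Lambda^t$ for all $s,t\ge 0$; its generator is $\mathcal L=\lim_{t\to 0^+}(\Lambda^t-\mathrm{id})/t$. For a linear map $T$ on $\mathcal B(\mathcal H_S)$, $T^*$ denotes the dual map, $\mathrm{Tr}(A\,T^*(\rho))=\mathrm{Tr}(T(A)\rho)$. A repeated interaction model on $\mathcal H_S$ consists of a finite-dimensional Hilbert space $\mathcal H_B$, self-adjoint operators $H_S\in\mathcal B(\mathcal H_S)$ and $H_{SB}\in\mathcal B(\mathcal H_S\otimes\mathcal H_B)$, and a state (density matrix, possibly mixed) $\rho_B$ on $\mathcal H_B$ such that $\mathrm{Tr}_B(H_{SB}(\mathbf 1_S\otimes\rho_B))=0$. For $\tau>0$ put $U_\tau=\exp(-i\tau H_S\otimes\mathbf 1_B-i\sqrt\tau H_{SB})$ and let the map $\Lambda_\tau$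 on $\mathcal B(\mathcal H_S)$ be defined by $(\Lambda_\tau)^*(\rho)=\mathrm{Tr}_B(U_\tau(\rho\otimes\rho_B)U_\tau^*)$. Let $\Phi$ be defined by $\Phi^*(\rho)=\mathrm{Tr}_B(H_{SB}(\rho\otimes\rho_B)H_{SB})$. (1) For every repeated interaction model, $\Phi$ is completely positive, and there is a QMS $(\Lambda^t)_{t\ge 0}$ such that, as $\tau\to 0^+$, $\Lambda_\tau^{\lfloor t/\tau\rfloor}\to\Lambda^t$ locally uniformly in $t\in[0,\infty)$, in the following sense: for all $T\ge 0$, the norm of $(\Lambda_\tau^{\lfloor t/\tau\rfloor})^*-(\Lambda^t)^*$ as an operator on the trace-class operators with the trace norm tends to $0$ uniformly in $t\in[0,T]$. The generator of $(\Lambda^t)_{t\ge 0}$ is $$\mathcal L(A)=i[H_S,A]+\Phi(A)-\tfrac12\{\Phi(\mathbf 1_S),A\}.$$ (2) Conversely, for every QMS $(\Lambda^t)_{t\ge 0}$ on $\mathcal H_S$ there is a repeated interaction model on $\mathcal H_S$ such that $\Lambda_\tau^{\lfloor t/\tau\rfloor}\to\Lambda^t$ in the sense of (1), and the generator of $(\Lambda^t)_{t\ge0}$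 is given by the formula in (1). -/

import Mathlib

open Filter Topology Matrix
open scoped NNReal Kronecker ComplexOrder MatrixOrder CStarAlgebra Matrix.Norms.L2Operator

noncomputable section

namespace RepeatedInteraction

/-- Operators on the finite-dimensional Hilbert space `ℂ^n`, with the operator norm. -/
abbrev Op (n : Type*) : Type _ := Matrix n n ℂ

/-- Super-operators: (bounded) linear maps on the space of operators on `ℂ^n`, with the norm
topology. Multiplication is composition. -/
abbrev SuperOp (n : Type*) [Fintype n] [DecidableEq n] : Type _ := Op n →L[ℂ] Op n

/-- A super-operator is completely positive, in the sense of Mathlib's completely positive maps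
between C⋆-algebras. -/
def IsCompletelyPositive {n : Type*} [Fintype n] [DecidableEq n] (T : SuperOp n) : Prop :=
  ∃ T' : Op n →CP Op n, ∀ A, T' A = T A

/-- The trace norm `Tr |A|`, i.e. the sum of the singular values of `A`. -/
def traceNorm {n : Type*} [Fintype n] [DecidableEq n] (A : Op n) : ℝ :=
  ∑ k, √((isHermitian_conjTranspose_mul_self A).eigenvalues k)

/-- The partial trace `Tr_B` over the second factor of `ℂ^n ⊗ ℂ^m = ℂ^(n × m)`. -/
def partialTrace {n m : Type*} [Fintype m] (X : Op (n × m)) : Op n :=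
  Matrix.of fun i j => ∑ b, X (i, b) (j, b)

/-- The dual of a super-operator for the trace pairing: `Tr (T A * ρ) = Tr (A * dual T ρ)`
(see `trace_mul_dual` and `eq_dual_of_trace`). It exchanges the Heisenberg and the Schrödinger
representations. -/
def dual {n : Type*} [Fintype n] [DecidableEq n] (T : SuperOp n) : SuperOp n :=
  LinearMap.toContinuousLinearMap
    { toFun := fun ρ => Matrix.of fun i j => trace (T (Matrix.single j i 1) * ρ)
      map_add' := fun ρ σ => by
        ext i j
        simp [Matrix.mul_add]
      map_smul' := fun c ρ => by
        ext i j
        simp }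

theorem dual_apply {n : Type*} [Fintype n] [DecidableEq n] (T : SuperOp n) (ρ : Op n) (i j : n) :
    dual T ρ i j = trace (T (Matrix.single j i 1) * ρ) := rfl

theorem trace_mul_dual {n : Type*} [Fintype n] [DecidableEq n] (T : SuperOp n) (A ρ : Op n) :
    trace (A * dual T ρ) = trace (T A * ρ) := by
  have hA : T A = ∑ i, ∑ j, A i j • T (Matrix.single i j 1) := by
    conv_lhs => rw [Matrix.matrix_eq_sum_single A]
    simp only [map_sum]
    refine Finset.sum_congr rfl fun i _ => Finset.sum_congr rfl fun j _ => ?_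
    rw [← map_smul, Matrix.smul_single, smul_eq_mul, mul_one]
  rw [hA]
  simp only [Finset.sum_mul, Matrix.trace_sum, Matrix.smul_mul, Matrix.trace_smul, smul_eq_mul,
    ← dual_apply]
  simp [Matrix.trace, Matrix.mul_apply]

theorem eq_dual_of_trace {n : Type*} [Fintype n] [DecidableEq n] (T T' : SuperOp n)
    (h : ∀ A ρ, trace (A * T' ρ) = trace (T A * ρ)) : T' = dual T := by
  ext ρ i j
  have := h (Matrix.single j i 1) ρ
  rw [← trace_mul_dual, Matrix.trace_single_mul, Matrix.trace_single_mul] at this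
  simpa using this

/-- A continuous-time quantum Markov semigroup in the Heisenberg representation, on the
finite-dimensional Hilbert space `ℂ^n`. -/
structure IsQMS {n : Type*} [Fintype n] [DecidableEq n] (Λ : ℝ≥0 → SuperOp n) : Prop where
  completelyPositive : ∀ t, IsCompletelyPositive (Λ t)
  map_one : ∀ t, Λ t 1 = 1
  zero : Λ 0 = 1
  add : ∀ s t, Λ (s + t) = Λ s * Λ t
  continuous : Continuous Λ

/-- `L` is the (infinitesimal) generator of `Λ`: the right derivative of `Λ` at time `0`. -/
def IsGenerator {n : Type*} [Fintype n] [DecidableEq n] (Λ : ℝ≥0 → SuperOp n) (L : SuperOp n) :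
    Prop :=
  Tendsto (fun t : ℝ≥0 => ((t : ℝ)⁻¹ : ℂ) • (Λ t - 1)) (𝓝[>] 0) (𝓝 L)

/-- The Lindblad super-operator `A ↦ i [H, A] + Φ A - ½ {Φ 1, A}`. -/
def lindbladian {n : Type*} [Fintype n] [DecidableEq n] (H : Op n) (Φ : SuperOp n) : SuperOp n :=
  LinearMap.toContinuousLinearMap
    { toFun := fun A =>
        Complex.I • (H * A - A * H) + Φ A - (1 / 2 : ℂ) • (Φ 1 * A + A * Φ 1)
      map_add' := fun A B => by
        simp only [Matrix.mul_add, Matrix.add_mul, map_add, smul_add, smul_sub]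
        abel
      map_smul' := fun c A => by
        simp only [Matrix.mul_smul, Matrix.smul_mul, map_smul, smul_sub, smul_add, RingHom.id_apply,
          smul_comm c] }

/-- The map `ρ ↦ Tr_B (X (ρ ⊗ σ) Y)`. -/
def sandwich {n m : Type*} [Fintype n] [DecidableEq n] [Fintype m]
    (X Y : Op (n × m)) (σ : Op m) : SuperOp n :=
  LinearMap.toContinuousLinearMap
    { toFun := fun ρ => partialTrace (X * (ρ ⊗ₖ σ) * Y)
      map_add' := fun ρ ρ' => by
        ext i j
        simp [partialTrace, Matrix.add_kronecker, Matrix.mul_add, Matrix.add_mul,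
          Finset.sum_add_distrib]
      map_smul' := fun c ρ => by
        ext i j
        simp [partialTrace, Matrix.smul_kronecker, Finset.mul_sum] }

/-- The data `(H_S, H_SB, ρ_B)` of a repeated interaction model, with system space `ℂ^n` and bath
space `ℂ^m`. -/
structure Model (n m : Type*) [Fintype n] [DecidableEq n] [Fintype m] [DecidableEq m] where
  HS : Op n
  HSB : Op (n × m)
  rhoB : Op m
  isHermitian_HS : HS.IsHermitian
  isHermitian_HSB : HSB.IsHermitian
  posSemidef_rhoB : rhoB.PosSemidef
  trace_rhoB : rhoB.trace = 1
  centered : partialTrace (HSB * ((1 : Op n) ⊗ₖ rhoB)) = 0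

namespace Model

variable {n m : Type*} [Fintype n] [DecidableEq n] [Fintype m] [DecidableEq m]

/-- `U_τ = exp (-i τ H_S ⊗ 1 - i √τ H_SB)`. -/
def U (M : Model n m) (τ : ℝ) : Op (n × m) :=
  NormedSpace.exp
    (-(Complex.I * (τ : ℂ)) • (M.HS ⊗ₖ (1 : Op m)) - (Complex.I * ((√τ : ℝ) : ℂ)) • M.HSB)

/-- The Heisenberg evolution `Λ_τ` over one interaction, defined through its Schrödinger dual
`ρ ↦ Tr_B (U_τ (ρ ⊗ ρ_B) U_τ^*)`. -/
def step (M : Model n m) (τ : ℝ) : SuperOp n :=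
  dual (sandwich (M.U τ) (M.U τ)ᴴ M.rhoB)

/-- The map `Φ`, defined through its dual `ρ ↦ Tr_B (H_SB (ρ ⊗ ρ_B) H_SB)`. -/
def Phi (M : Model n m) : SuperOp n :=
  dual (sandwich M.HSB M.HSB M.rhoB)

/-- As `τ → 0⁺`, the maps `Λ_τ ^ ⌊t / τ⌋` converge to `Λ t`, locally uniformly in `t ∈ [0, ∞)`:
their duals converge in the operator norm induced by the trace norm. -/
def ConvergesTo (M : Model n m) (Λ : ℝ≥0 → SuperOp n) : Prop :=
  ∀ T : ℝ≥0, ∀ ε > (0 : ℝ), ∀ᶠ τ : ℝ in 𝓝[>] 0, ∀ t ≤ T, ∀ ρ : Op n,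
    traceNorm (dual (M.step τ ^ ⌊(t : ℝ) / τ⌋₊) ρ - dual (Λ t) ρ) ≤ ε * traceNorm ρ

end Model

end RepeatedInteraction

end

/-! For the direct half, cyclicity of the trace gives `Λ_τ(A) = Tr_B(U_τ^* (A ⊗ 1) U_τ (1 ⊗ ρ_B))`,
which is bilinear in `(U_τ^*, U_τ)` (`dual_sandwich`). Expanding both factors to second order in
`√τ`, the centering condition kills the `√τ` term and the coefficient of `τ` is the Lindbladian:
`Λ_τ = 1 + τ L + o(τ)` (`step_expansion`). An Euler product argument
(`eventually_norm_pow_floor_sub_exp_le`) then yields `exp (t L)`, locally uniformly in `t`. Each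
`Λ_τ` is completely positive and unital, and both properties pass to limits; for complete positivity
this is read off the Choi matrix.

Conversely, a norm-continuous semigroup is `exp (t L)`. The Choi matrix of the identity has rank at
most one, with range in the span of the maximally entangled vector. Compressing to the orthogonal
complement removes it from `(Λ^t - 1) / t`, so the compressed Choi matrix of `L` is a limit of
positive matrices. Factoring that compression gives Kraus operators `V a`; the remaining part of `L`
has the form `A ↦ K^* A + A K`, and `L 1 = 0` turns this into a commutator and an anticommutator
(`exists_eq_lindbladian`). The interaction `∑ V a ⊗ |a⟩⟨e| + h.c.` with bath state `|e⟩⟨e|` and `V e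
= 0` is centered and has exactly these Kraus operators (`Phi_ofKraus`), so the direct half applies
to it. -/

/-! ### One-parameter semigroups and Euler products in a Banach algebra -/

section BanachAlgebra

open Asymptotics NormedSpace

variable {𝔸 : Type*} [NormedRing 𝔸] [NormedAlgebra ℝ 𝔸] [CompleteSpace 𝔸]

theorem hasDerivAt_exp_smul (L : 𝔸) (t : ℝ) :
    HasDerivAt (fun s : ℝ => exp (s • L)) (exp (t • L) * L) t :=
  hasDerivAt_exp_smul_const L t

theorem continuous_exp_smul (L : 𝔸) : Continuous fun t : ℝ => exp (t • L) :=
  continuous_iff_continuousAt.2 fun t => (hasDerivAt_exp_smul L t).continuousAt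

theorem tendsto_inv_smul_exp_smul_sub_one (L : 𝔸) :
    Tendsto (fun t : ℝ => t⁻¹ • (exp (t • L) - 1)) (𝓝[>] 0) (𝓝 L) := by
  have h := (hasDerivAt_exp_smul L 0).tendsto_slope_zero_right
  simpa only [zero_add, zero_smul, exp_zero, one_mul] using h

theorem exp_smul_sub_one_sub_isLittleO (L : 𝔸) :
    (fun t : ℝ => exp (t • L) - 1 - t • L) =o[𝓝 0] fun t => t := by
  simpa [hasDerivAt_iff_isLittleO] using hasDerivAt_exp_smul L 0

theorem exp_zero_smul {𝔸 : Type*} [NormedRing 𝔸] [NormedAlgebra ℝ 𝔸] (L : 𝔸) : exp ((0 : ℝ) • L) = 1 := by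
  rw [zero_smul, exp_zero]

theorem exp_add_smul (L : 𝔸) (s t : ℝ) :
    exp ((s + t) • L) = exp (s • L) * exp (t • L) := by
  let _ : NormedAlgebra ℚ 𝔸 := NormedAlgebra.restrictScalars ℚ ℝ 𝔸
  rw [add_smul]
  exact exp_add_of_commute (((Commute.refl L).smul_left s).smul_right t)

/-- A norm-continuous one-parameter semigroup in a Banach algebra is an exponential. -/
theorem exists_eq_exp_of_continuous_semigroup (f : ℝ≥0 → 𝔸) (hf : Continuous f)
    (h0 : f 0 = 1) (hadd : ∀ s t, f (s + t) = f s * f t) :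
    ∃ L : 𝔸, ∀ t : ℝ≥0, f t = exp ((t : ℝ) • L) := by
  set g : ℝ → 𝔸 := fun t => f t.toNNReal with hg
  have hgc : Continuous g := hf.comp continuous_real_toNNReal
  have hg0 : g 0 = 1 := by simp [hg, h0]
  have hgadd : ∀ s t : ℝ, 0 ≤ s → 0 ≤ t → g (s + t) = g s * g t := fun s t hs ht => by
    simp [hg, Real.toNNReal_add hs ht, hadd]
  set G : ℝ → 𝔸 := fun t => ∫ s in (0 : ℝ)..t, g s with hG
  have hGd : ∀ t, HasDerivAt G (g t) t := fun t =>
    intervalIntegral.integral_hasDerivAt_right (hgc.intervalIntegrable _ _)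
      (hgc.stronglyMeasurableAtFilter _ _) hgc.continuousAt
  -- The averages `G a / a` tend to `g 0 = 1` and the units form an open set.
  obtain ⟨a, ha, hunit⟩ : ∃ a : ℝ, 0 < a ∧ IsUnit (G a) := by
    have h1 : Tendsto (fun t : ℝ => t⁻¹ • (G (0 + t) - G 0)) (𝓝[>] 0) (𝓝 1) := by
      have := (hGd 0).tendsto_slope_zero_right
      rwa [hg0] at this
    have h2 := h1.eventually (Units.isOpen.mem_nhds (isUnit_one : IsUnit (1 : 𝔸)))
    obtain ⟨a, ha1, ha⟩ := (h2.and self_mem_nhdsWithin).exists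
    have ha0 : 0 < a := ha
    refine ⟨a, ha0, ?_⟩
    have hG0 : G 0 = 0 := by simp [hG]
    have h3 : IsUnit (a⁻¹ • G a) := by simpa [hG0] using ha1
    have h4 : IsUnit (Units.mk0 a ha0.ne' • (a⁻¹ • G a)) := h3.smul _
    simpa [Units.smul_def, smul_smul, ha0.ne'] using h4
  obtain ⟨V, hV⟩ := hunit
  -- Integrating the semigroup law and dividing by the unit `G a` expresses `g` through its own
  -- primitive, so continuity upgrades to differentiability.
  have key : ∀ t : ℝ, 0 ≤ t → g t * G a = G (t + a) - G t := by
    intro t ht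
    have e1 : g t * G a = ∫ s in (0 : ℝ)..a, g (s + t) := by
      have : ∫ s in (0 : ℝ)..a, g (s + t) = ∫ s in (0 : ℝ)..a, g t * g s :=
        intervalIntegral.integral_congr fun s hs => by
          rw [Set.uIcc_of_le ha.le] at hs
          simp only [add_comm s t]
          exact hgadd t s ht hs.1
      rw [this]
      exact ((ContinuousLinearMap.mul ℝ 𝔸 (g t)).intervalIntegral_comp_comm
        (hgc.intervalIntegrable _ _)).symm
    rw [e1, intervalIntegral.integral_comp_add_right, zero_add, add_comm a t]
    exact (intervalIntegral.integral_interval_sub_left (hgc.intervalIntegrable _ _)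
      (hgc.intervalIntegrable _ _)).symm
  have key' : ∀ t : ℝ, 0 ≤ t → g t = (G (t + a) - G t) * (↑V⁻¹ : 𝔸) := by
    intro t ht
    rw [← key t ht, ← hV, Units.mul_inv_cancel_right]
  set L : 𝔸 := (g a - 1) * (↑V⁻¹ : 𝔸) with hL
  have hgd : ∀ t : ℝ, 0 ≤ t → HasDerivWithinAt g (g t * L) (Set.Ici t) t := by
    intro t ht
    have d1 : HasDerivAt (fun t => (G (t + a) - G t) * (↑V⁻¹ : 𝔸))
        ((g (t + a) - g t) * (↑V⁻¹ : 𝔸)) t :=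
      (((hGd (t + a)).comp_add_const t a).sub (hGd t)).mul_const _
    have e : (g (t + a) - g t) * (↑V⁻¹ : 𝔸) = g t * L := by
      rw [hgadd t a ht ha.le, hL, ← mul_assoc, mul_sub, mul_one]
    rw [e] at d1
    exact d1.hasDerivWithinAt.congr (fun s hs => key' s (ht.trans hs)) (key' t ht)
  refine ⟨L, fun t => ?_⟩
  -- Uniqueness for `g' = g L`: multiply by the inverse of the candidate solution and check that the
  -- right derivative vanishes.
  have hconst : ∀ x ∈ Set.Icc (0 : ℝ) t, g x * exp (x • (-L)) = g 0 * exp ((0 : ℝ) • (-L)) := by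
    apply constant_of_has_deriv_right_zero
    · exact (hgc.mul (continuous_exp_smul (-L))).continuousOn
    · intro x hx
      have h := (hgd x hx.1).mul (hasDerivAt_exp_smul_const' (-L) x).hasDerivWithinAt
      have e : g x * L * exp (x • -L) + g x * (-L * exp (x • -L)) = 0 := by
        rw [neg_mul, mul_neg, ← mul_assoc (g x) L, add_neg_cancel]
      exact e ▸ h
  have h := hconst t ⟨t.2, le_rfl⟩
  rw [hg0, zero_smul, exp_zero, mul_one] at h
  have h2 : exp ((t : ℝ) • -L) * exp ((t : ℝ) • L) = 1 := by
    have := exp_add_smul L (-(t : ℝ)) t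
    rw [neg_add_cancel, zero_smul, exp_zero] at this
    rw [smul_neg, ← neg_smul, ← this]
  have h3 : g t = f t := by simp [hg]
  rw [← h3, ← mul_one (g t), ← h2, ← mul_assoc, h, one_mul]

/-- Telescoping. The bounds on `A` and `B` are asymmetric because in the application the powers of
`B` are values of `exp` on a compact interval, while `A` is only known to have norm at most `1 +
O(τ)`. -/
theorem norm_pow_sub_pow_le {𝔸 : Type*} [NormedRing 𝔸] (A B : 𝔸) (a b c : ℝ) (ha : 1 ≤ a) (hA : ‖A‖ ≤ a) (hc : ‖A - B‖ ≤ c)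
    (N : ℕ) (hB : ∀ k ≤ N, ‖B ^ k‖ ≤ b) : ‖A ^ N - B ^ N‖ ≤ N * (c * b) * a ^ N := by
  have hb0 : 0 ≤ b := (norm_nonneg _).trans (hB 0 (Nat.zero_le _))
  have hc0 : 0 ≤ c := (norm_nonneg _).trans hc
  induction N with
  | zero => simp
  | succ k ih =>
    have e : A ^ (k + 1) - B ^ (k + 1) = A * (A ^ k - B ^ k) + (A - B) * B ^ k := by
      rw [pow_succ', pow_succ']; noncomm_ring
    have ih' := ih fun j hj => hB j (hj.trans (Nat.le_succ k))
    have h1 : ‖A * (A ^ k - B ^ k)‖ ≤ a * (k * (c * b) * a ^ k) :=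
      (norm_mul_le _ _).trans (mul_le_mul hA ih' (norm_nonneg _) (by linarith))
    have h2 : ‖(A - B) * B ^ k‖ ≤ c * b :=
      (norm_mul_le _ _).trans (mul_le_mul hc (hB k (Nat.le_succ k)) (norm_nonneg _) hc0)
    have h3 : c * b ≤ c * b * a ^ (k + 1) :=
      le_mul_of_one_le_right (mul_nonneg hc0 hb0) (one_le_pow₀ ha)
    rw [e]
    refine (norm_add_le _ _).trans ?_
    push_cast
    calc _ ≤ a * (k * (c * b) * a ^ k) + c * b * a ^ (k + 1) := by linarith
      _ = _ := by ring

/-- Euler approximation of the exponential: if `F τ = 1 + τ L + o(τ)`, then `F τ ^ ⌊t / τ⌋`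
converges to `exp (t L)`, locally uniformly in `t`. -/
theorem eventually_norm_pow_floor_sub_exp_le (h1 : ‖(1 : 𝔸)‖ ≤ 1) (F : ℝ → 𝔸) (L : 𝔸)
    (hF : (fun τ => F τ - 1 - τ • L) =o[𝓝[>] 0] fun τ : ℝ => τ) (T ε : ℝ) (hε : 0 < ε) :
    ∀ᶠ τ in 𝓝[>] (0 : ℝ), ∀ t, 0 ≤ t → t ≤ T → ‖F τ ^ ⌊t / τ⌋₊ - exp (t • L)‖ ≤ ε := by
  by_cases hT : 0 ≤ T
  swap
  · exact Eventually.of_forall fun τ t h0 ht => absurd (h0.trans ht) hT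
  have hexpc := continuous_exp_smul L
  obtain ⟨b, hb⟩ := (isCompact_Icc (a := (0 : ℝ)) (b := T)).exists_bound_of_continuousOn
    hexpc.continuousOn
  have hb0 : 0 ≤ b := (norm_nonneg _).trans (hb 0 ⟨le_rfl, hT⟩)
  set M : ℝ := ‖L‖ + 1 with hM
  have hM0 : 0 ≤ M := by positivity
  -- `δ` is the allowed one-step error per unit time: about `T / τ` steps, each amplified by at most
  -- `b * exp (M T)`, must cost at most `ε / 2`.
  obtain ⟨δ, hδ, hδε⟩ : ∃ δ : ℝ, 0 < δ ∧ δ * (T * b * Real.exp (M * T)) ≤ ε / 2 := by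
    set q := T * b * Real.exp (M * T)
    have hq : 0 ≤ q := by positivity
    refine ⟨ε / 2 / (q + 1), by positivity, ?_⟩
    rw [div_mul_eq_mul_div, div_le_iff₀ (by positivity)]
    nlinarith
  have hd : (fun τ : ℝ => F τ - exp (τ • L)) =o[𝓝[>] 0] fun τ : ℝ => τ :=
    (hF.sub ((exp_smul_sub_one_sub_isLittleO L).mono nhdsWithin_le_nhds)).congr_left
      fun τ => by abel
  obtain ⟨η, hη, hun⟩ := Metric.uniformContinuousOn_iff.1
    ((isCompact_Icc (a := (0 : ℝ)) (b := T)).uniformContinuousOn_of_continuous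
      hexpc.continuousOn) (ε / 2) (half_pos hε)
  filter_upwards [hd.def hδ, hF.def one_pos, self_mem_nhdsWithin,
    nhdsWithin_le_nhds (Iio_mem_nhds hη)] with τ e1 e2 hτ hτη t ht0 htT
  have hτ : 0 < τ := hτ
  have hτη : τ < η := hτη
  rw [Real.norm_of_nonneg hτ.le] at e1 e2
  set N := ⌊t / τ⌋₊
  have hN : (N : ℝ) * τ ≤ t := (le_div_iff₀ hτ).1 (Nat.floor_le (div_nonneg ht0 hτ.le))
  have hN' : t < (N : ℝ) * τ + τ := by
    have := (div_lt_iff₀ hτ).1 (Nat.lt_floor_add_one (t / τ))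
    linarith
  have hpow : ∀ k : ℕ, exp (τ • L) ^ k = exp ((k * τ : ℝ) • L) := by
    intro k
    induction k with
    | zero => simp
    | succ k ih => rw [pow_succ, ih, ← exp_add_smul]; congr 2; push_cast; ring
  have hA : ‖F τ‖ ≤ 1 + τ * M := by
    have : F τ = (F τ - 1 - τ • L) + (1 + τ • L) := by abel
    rw [this]
    refine (norm_add_le _ _).trans ?_
    have h3 : ‖(1 : 𝔸) + τ • L‖ ≤ 1 + τ * ‖L‖ := by
      refine (norm_add_le _ _).trans (add_le_add h1 ?_)
      rw [norm_smul, Real.norm_of_nonneg hτ.le]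
    rw [hM]; linarith
  have hmain := norm_pow_sub_pow_le (F τ) (exp (τ • L)) (1 + τ * M) b (δ * τ)
    (by nlinarith) hA e1 N fun k hk => by
      rw [hpow]
      refine hb _ ⟨by positivity, ?_⟩
      have : (k : ℝ) * τ ≤ N * τ := by gcongr
      linarith
  have hgrow : (1 + τ * M) ^ N ≤ Real.exp (M * T) := by
    calc (1 + τ * M) ^ N ≤ Real.exp (τ * M) ^ N := by
          gcongr
          linarith [Real.add_one_le_exp (τ * M)]
      _ = Real.exp (N * (τ * M)) := (Real.exp_nat_mul _ _).symm
      _ ≤ _ := Real.exp_le_exp.2 (by nlinarith)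
  have hfirst : ‖F τ ^ N - exp (τ • L) ^ N‖ ≤ ε / 2 := by
    refine hmain.trans (le_trans ?_ hδε)
    calc (N : ℝ) * (δ * τ * b) * (1 + τ * M) ^ N = δ * ((N * τ) * b * (1 + τ * M) ^ N) := by ring
      _ ≤ δ * (T * b * Real.exp (M * T)) := by
        gcongr
        linarith
  -- Rounding error of the floor: `N τ` lies within `τ < η` of `t`.
  have hsecond : ‖exp (τ • L) ^ N - exp (t • L)‖ ≤ ε / 2 := by
    rw [hpow, ← dist_eq_norm]
    refine (hun _ ⟨by positivity, by linarith⟩ _ ⟨ht0, htT⟩ ?_).le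
    rw [Real.dist_eq, abs_lt]
    constructor <;> linarith
  calc _ = ‖(F τ ^ N - exp (τ • L) ^ N) + (exp (τ • L) ^ N - exp (t • L))‖ := by
        rw [sub_add_sub_cancel]
    _ ≤ ε / 2 + ε / 2 := (norm_add_le _ _).trans (add_le_add hfirst hsecond)
    _ = ε := add_halves ε

end BanachAlgebra

namespace RepeatedInteraction

/-! ### Comparison of the trace norm with the operator norm -/

section TraceNorm

variable {n : Type*} [Fintype n] [DecidableEq n]

theorem sum_eigenvalues_conjTranspose_mul_self (A : Op n) :
    ∑ k, (isHermitian_conjTranspose_mul_self A).eigenvalues k = ∑ i, ∑ j, ‖A i j‖ ^ 2 := by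
  have h := (isHermitian_conjTranspose_mul_self A).trace_eq_sum_eigenvalues
  have h2 : trace (Aᴴ * A) = ((∑ i, ∑ j, ‖A i j‖ ^ 2 : ℝ) : ℂ) := by
    rw [Finset.sum_comm]
    simp [Matrix.trace, Matrix.mul_apply, Complex.conj_mul']
  rw [h2] at h
  exact (Complex.ofReal_injective (by simpa using h)).symm

theorem eigenvalues_conjTranspose_mul_self_nonneg (A : Op n) (k : n) :
    0 ≤ (isHermitian_conjTranspose_mul_self A).eigenvalues k :=
  (posSemidef_conjTranspose_mul_self A).eigenvalues_nonneg k

/-- Goes through the Hilbert–Schmidt norm: the sum of the squared singular values is at most the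
square of their sum. -/
theorem norm_entry_le_traceNorm (A : Op n) (i j : n) : ‖A i j‖ ≤ traceNorm A := by
  have h0 : 0 ≤ traceNorm A := Finset.sum_nonneg fun k _ => Real.sqrt_nonneg _
  refine le_of_sq_le_sq ?_ h0
  calc ‖A i j‖ ^ 2 ≤ ∑ j, ‖A i j‖ ^ 2 :=
        Finset.single_le_sum (f := fun j => ‖A i j‖ ^ 2) (fun _ _ => by positivity)
          (Finset.mem_univ j)
    _ ≤ ∑ i, ∑ j, ‖A i j‖ ^ 2 :=
        Finset.single_le_sum (f := fun i => ∑ j, ‖A i j‖ ^ 2) (fun _ _ => by positivity)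
          (Finset.mem_univ i)
    _ = ∑ k, √((isHermitian_conjTranspose_mul_self A).eigenvalues k) ^ 2 := by
        rw [← sum_eigenvalues_conjTranspose_mul_self]
        exact Finset.sum_congr rfl fun k _ =>
          (Real.sq_sqrt (eigenvalues_conjTranspose_mul_self_nonneg A k)).symm
    _ ≤ traceNorm A ^ 2 := Finset.sum_sq_le_sq_sum_of_nonneg fun k _ => Real.sqrt_nonneg _

theorem exists_norm_le_traceNorm (n : Type*) [Fintype n] [DecidableEq n] :
    ∃ C : ℝ, 0 ≤ C ∧ ∀ A : Op n, ‖A‖ ≤ C * traceNorm A := by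
  refine ⟨∑ i : n, ∑ j : n, ‖(Matrix.single i j 1 : Op n)‖, by positivity, fun A => ?_⟩
  have hA : A = ∑ i, ∑ j, A i j • (Matrix.single i j 1 : Op n) := by
    conv_lhs => rw [Matrix.matrix_eq_sum_single A]
    simp
  conv_lhs => rw [hA]
  rw [Finset.sum_mul]
  refine (norm_sum_le _ _).trans (Finset.sum_le_sum fun i _ => ?_)
  rw [Finset.sum_mul]
  refine (norm_sum_le _ _).trans (Finset.sum_le_sum fun j _ => ?_)
  rw [norm_smul, mul_comm]
  exact mul_le_mul_of_nonneg_left (norm_entry_le_traceNorm A i j) (norm_nonneg _)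

theorem exists_traceNorm_le_norm (n : Type*) [Fintype n] [DecidableEq n] :
    ∃ C : ℝ, 0 ≤ C ∧ ∀ A : Op n, traceNorm A ≤ C * ‖A‖ := by
  set c : n → n → ℝ := fun i j =>
    ‖LinearMap.toContinuousLinearMap (Matrix.entryLinearMap ℂ ℂ i j : Op n →ₗ[ℂ] ℂ)‖
  have hc : ∀ (A : Op n) i j, ‖A i j‖ ≤ c i j * ‖A‖ := fun A i j =>
    (LinearMap.toContinuousLinearMap (Matrix.entryLinearMap ℂ ℂ i j : Op n →ₗ[ℂ] ℂ)).le_opNorm A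
  refine ⟨∑ _k : n, ∑ i, ∑ j, c i j, by positivity, fun A => ?_⟩
  rw [Finset.sum_mul]
  refine Finset.sum_le_sum fun k _ => ?_
  have h1 : ∑ i, ∑ j, ‖A i j‖ ≤ (∑ i, ∑ j, c i j) * ‖A‖ := by
    simp only [Finset.sum_mul]
    exact Finset.sum_le_sum fun i _ => Finset.sum_le_sum fun j _ => hc A i j
  refine le_trans (Real.sqrt_le_iff.2 ⟨by positivity, ?_⟩) h1
  calc _ ≤ ∑ k, (isHermitian_conjTranspose_mul_self A).eigenvalues k :=
        Finset.single_le_sum (fun k _ => eigenvalues_conjTranspose_mul_self_nonneg A k)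
          (Finset.mem_univ k)
    _ = ∑ i, ∑ j, ‖A i j‖ ^ 2 := sum_eigenvalues_conjTranspose_mul_self A
    _ ≤ ∑ i, (∑ j, ‖A i j‖) ^ 2 := Finset.sum_le_sum fun i _ =>
        Finset.sum_sq_le_sq_sum_of_nonneg fun j _ => norm_nonneg _
    _ ≤ _ := Finset.sum_sq_le_sq_sum_of_nonneg fun i _ => by positivity

theorem dual_sub (S T : SuperOp n) : dual (S - T) = dual S - dual T := by
  symm
  apply eq_dual_of_trace
  intro A ρ
  simp [Matrix.mul_sub, Matrix.sub_mul, trace_mul_dual]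

/-- The dual as a linear map. -/
noncomputable def dualLinearMap (n : Type*) [Fintype n] [DecidableEq n] : SuperOp n →ₗ[ℂ] SuperOp n where
  toFun := dual
  map_add' S T := by
    symm
    apply eq_dual_of_trace
    intro A ρ
    simp [Matrix.mul_add, Matrix.add_mul, trace_mul_dual]
  map_smul' c T := by
    symm
    apply eq_dual_of_trace
    intro A ρ
    simp [trace_mul_dual]

/-- The dual of a super-operator is bounded, as an operator for the trace norm, by a multiple of
its norm. -/
theorem exists_traceNorm_dual_le (n : Type*) [Fintype n] [DecidableEq n] :
    ∃ C : ℝ, 0 ≤ C ∧ ∀ (T : SuperOp n) (ρ : Op n),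
      traceNorm (dual T ρ) ≤ C * ‖T‖ * traceNorm ρ := by
  obtain ⟨C₁, h₁, H₁⟩ := exists_norm_le_traceNorm n
  obtain ⟨C₂, h₂, H₂⟩ := exists_traceNorm_le_norm n
  set D := LinearMap.toContinuousLinearMap (dualLinearMap n)
  refine ⟨C₂ * ‖D‖ * C₁, by positivity, fun T ρ => ?_⟩
  have h3 : ‖dual T‖ ≤ ‖D‖ * ‖T‖ := D.le_opNorm T
  calc traceNorm (dual T ρ) ≤ C₂ * ‖dual T ρ‖ := H₂ _
    _ ≤ C₂ * (‖D‖ * ‖T‖ * (C₁ * traceNorm ρ)) := by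
        gcongr
        exact ((dual T).le_opNorm ρ).trans
          (mul_le_mul h3 (H₁ ρ) (norm_nonneg _) (by positivity))
    _ = _ := by ring

theorem traceNorm_nonneg (A : Op n) : 0 ≤ traceNorm A :=
  Finset.sum_nonneg fun _ _ => Real.sqrt_nonneg _

/-- In finite dimension the dual is bounded for the trace norm by a constant times the norm of the
super-operator, so all estimates can be made in the Heisenberg picture. -/
theorem Model.convergesTo_of_norm {m : Type*} [Fintype m] [DecidableEq m] (M : Model n m)
    (Λ : ℝ≥0 → SuperOp n)
    (h : ∀ T ε : ℝ, 0 < ε → ∀ᶠ τ : ℝ in 𝓝[>] 0, ∀ t : ℝ≥0, (t : ℝ) ≤ T →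
      ‖M.step τ ^ ⌊(t : ℝ) / τ⌋₊ - Λ t‖ ≤ ε) : M.ConvergesTo Λ := by
  intro T ε hε
  obtain ⟨C, hC, H⟩ := exists_traceNorm_dual_le n
  filter_upwards [h T (ε / (C + 1)) (by positivity)] with τ hτ t ht ρ
  have h1 := hτ t (by exact_mod_cast ht)
  rw [← _root_.sub_apply, ← dual_sub]
  refine (H _ ρ).trans (mul_le_mul_of_nonneg_right ?_ (traceNorm_nonneg ρ))
  calc C * _ ≤ (C + 1) * (ε / (C + 1)) := by gcongr; linarith
    _ = ε := by field_simp

end TraceNorm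

/-! ### Choi matrices and Kraus operators -/

section CompletelyPositive

variable {n : Type*} [Fintype n] [DecidableEq n]

/-- The Choi matrix of a super-operator. -/
noncomputable def choi (T : SuperOp n) : Matrix (n × n) (n × n) ℂ :=
  Matrix.of fun p q => T (Matrix.single p.1 q.1 1) p.2 q.2

theorem choi_apply (T : SuperOp n) (p q : n × n) :
    choi T p q = T (Matrix.single p.1 q.1 1) p.2 q.2 := rfl

theorem ext_of_single {S T : SuperOp n}
    (h : ∀ i j, S (Matrix.single i j 1) = T (Matrix.single i j 1)) : S = T := by
  ext1 A
  rw [Matrix.matrix_eq_sum_single A]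
  simp only [map_sum]
  refine Finset.sum_congr rfl fun i _ => Finset.sum_congr rfl fun j _ => ?_
  have : (Matrix.single i j (A i j) : Op n) = A i j • Matrix.single i j 1 := by
    rw [Matrix.smul_single, smul_eq_mul, mul_one]
  rw [this, map_smul, map_smul, h]

/-- The super-operator `A ↦ ∑ p, (V p)ᴴ * A * V p` with Kraus operators `V p`. -/
noncomputable def kraus {ι : Type*} [Fintype ι] (V : ι → Op n) : SuperOp n :=
  LinearMap.toContinuousLinearMap
    { toFun := fun A => ∑ p, (V p)ᴴ * A * V p
      map_add' := fun A B => by simp [Matrix.mul_add, Matrix.add_mul, Finset.sum_add_distrib]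
      map_smul' := fun c A => by simp [Finset.smul_sum] }

theorem kraus_apply {ι : Type*} [Fintype ι] (V : ι → Op n) (A : Op n) :
    kraus V A = ∑ p, (V p)ᴴ * A * V p := rfl

theorem kraus_mul_kraus {ι κ : Type*} [Fintype ι] [Fintype κ] (V : ι → Op n) (W : κ → Op n) :
    kraus V * kraus W = kraus fun p : ι × κ => W p.2 * V p.1 := by
  ext1 A
  simp only [mul_apply_eq_comp, kraus_apply, Fintype.sum_prod_type,
    Finset.mul_sum, Finset.sum_mul, conjTranspose_mul, Matrix.mul_assoc]

/-- On block matrices, each Kraus term acts as conjugation by the block-diagonal matrix with `V p`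
on the diagonal, which preserves positivity. -/
theorem isCompletelyPositive_kraus {ι : Type*} [Fintype ι] (V : ι → Op n) :
    IsCompletelyPositive (kraus V) := by
  refine ⟨⟨(kraus V : Op n →ₗ[ℂ] Op n), fun k M hM => ?_⟩, fun A => rfl⟩
  let D : ι → CStarMatrix (Fin k) (Fin k) (Op n) := fun p =>
    CStarMatrix.ofMatrix (Matrix.diagonal fun _ => V p)
  have h : M.map (kraus V : Op n →ₗ[ℂ] Op n) = ∑ p, star (D p) * M * D p := by
    refine CStarMatrix.ext fun i j => ?_
    have h1 : (∑ p, star (D p) * M * D p) i j = ∑ p, (star (D p) * M * D p) i j :=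
      Matrix.sum_apply i j _ _
    rw [h1, CStarMatrix.map_apply]
    refine Finset.sum_congr rfl fun p _ => ?_
    have h2 : (star (D p) * M * D p : CStarMatrix (Fin k) (Fin k) (Op n))
        = CStarMatrix.ofMatrix ((Matrix.diagonal fun _ => (V p)ᴴ) * CStarMatrix.ofMatrix.symm M *
          Matrix.diagonal fun _ => V p) := by
      have : star (D p) = CStarMatrix.ofMatrix (Matrix.diagonal fun _ => (V p)ᴴ) := by
        exact Matrix.diagonal_conjTranspose _
      rw [this]
      rfl
    rw [h2]
    change _ = ((Matrix.diagonal fun _ => (V p)ᴴ) * CStarMatrix.ofMatrix.symm M *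
          Matrix.diagonal fun _ => V p : Matrix (Fin k) (Fin k) (Op n)) i j
    rw [Matrix.mul_diagonal, Matrix.diagonal_mul]
    rfl
  rw [h]
  exact Finset.sum_nonneg fun p _ => star_left_conjugate_nonneg hM (D p)

/-- Positive elements are sums of `star N * N`, and flattening blocks respects products and
adjoints, so each summand becomes a Gram matrix. -/
theorem posSemidef_of_cstarMatrix_nonneg {M : CStarMatrix n n (Op n)} (hM : 0 ≤ M) :
    (Matrix.of fun p q : n × n => M p.1 q.1 p.2 q.2).PosSemidef := by
  rw [StarOrderedRing.nonneg_iff] at hM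
  induction hM using AddSubmonoid.closure_induction with
  | mem x hx =>
    obtain ⟨N, rfl⟩ := hx
    have hG : (Matrix.of fun p q : n × n => (star N * N) p.1 q.1 p.2 q.2) =
        (Matrix.of fun p q : n × n => N p.1 q.1 p.2 q.2)ᴴ *
          Matrix.of fun p q : n × n => N p.1 q.1 p.2 q.2 := by
      ext p q
      rw [of_apply, CStarMatrix.mul_apply, Matrix.sum_apply, Matrix.mul_apply,
        Fintype.sum_prod_type]
      simp [Matrix.mul_apply, CStarMatrix.star_apply, star_eq_conjTranspose]
    rw [hG]
    exact posSemidef_conjTranspose_mul_self _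
  | zero => exact PosSemidef.zero
  | add x y _ _ hx hy => exact hx.add hy

theorem IsCompletelyPositive.posSemidef_choi {T : SuperOp n} (hT : IsCompletelyPositive T) :
    (choi T).PosSemidef := by
  obtain ⟨T', hT'⟩ := hT
  let E : CStarMatrix n n (Op n) := CStarMatrix.ofMatrix fun i j => Matrix.single i j 1
  have hE : 0 ≤ E := by
    by_cases hn : Nonempty n
    · obtain ⟨k⟩ := hn
      -- The block matrix of matrix units is `star R * R`, where only block row `k` of `R` is
      -- nonzero.
      let R : CStarMatrix n n (Op n) := CStarMatrix.ofMatrix fun i j =>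
        if i = k then Matrix.single k j 1 else 0
      have hR : ∀ i j, R i j = if i = k then Matrix.single k j 1 else 0 := fun _ _ => rfl
      have : E = star R * R := by
        refine CStarMatrix.ext fun i j => ?_
        rw [CStarMatrix.mul_apply, Finset.sum_eq_single k]
        · rw [CStarMatrix.star_apply, hR, hR, if_pos rfl, if_pos rfl, star_eq_conjTranspose,
            conjTranspose_single, star_one, single_mul_single_same, one_mul]
          rfl
        · intro b _ hb
          rw [hR b j, if_neg hb, mul_zero]
        · simp
      rw [this]
      exact star_mul_self_nonneg R
    · have : E = 0 := CStarMatrix.ext fun i j => (hn ⟨i⟩).elim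
      rw [this]
  have h := posSemidef_of_cstarMatrix_nonneg (T'.map_cstarMatrix_nonneg E hE)
  convert h using 1
  ext p q
  rw [choi_apply, ← hT']
  rfl

theorem choi_injective : Function.Injective (choi : SuperOp n → Matrix (n × n) (n × n) ℂ) :=
  fun _ _ h => ext_of_single fun i j => by
    ext k l
    exact congrFun (congrFun h (i, k)) (j, l)

/-- Factor the matrix as `star G * G`; each row of `G`, reshaped into a square matrix, is a Kraus
operator. -/
theorem exists_choi_kraus_eq {W : Matrix (n × n) (n × n) ℂ} (hW : W.PosSemidef) :
    ∃ V : n × n → Op n, choi (kraus V) = W := by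
  obtain ⟨G, rfl⟩ := CStarAlgebra.nonneg_iff_eq_star_mul_self.1 hW.nonneg
  refine ⟨fun p => Matrix.of fun i k => G p (i, k), ?_⟩
  ext ⟨i, k⟩ ⟨j, l⟩
  rw [choi_apply, kraus_apply, Matrix.sum_apply, Matrix.mul_apply]
  refine Finset.sum_congr rfl fun p _ => ?_
  simp [Matrix.mul_apply, Matrix.single_apply, ite_and]

theorem isCompletelyPositive_iff_posSemidef_choi {T : SuperOp n} :
    IsCompletelyPositive T ↔ (choi T).PosSemidef := by
  refine ⟨fun h => h.posSemidef_choi, fun h => ?_⟩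
  obtain ⟨V, hV⟩ := exists_choi_kraus_eq h
  rw [← choi_injective hV]
  exact isCompletelyPositive_kraus V

theorem IsCompletelyPositive.exists_eq_kraus {T : SuperOp n} (hT : IsCompletelyPositive T) :
    ∃ V : n × n → Op n, T = kraus V := by
  obtain ⟨V, hV⟩ := exists_choi_kraus_eq hT.posSemidef_choi
  exact ⟨V, (choi_injective hV).symm⟩

theorem IsCompletelyPositive.mul {S T : SuperOp n} (hS : IsCompletelyPositive S)
    (hT : IsCompletelyPositive T) : IsCompletelyPositive (S * T) := by
  obtain ⟨V, rfl⟩ := hS.exists_eq_kraus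
  obtain ⟨W, rfl⟩ := hT.exists_eq_kraus
  rw [kraus_mul_kraus]
  exact isCompletelyPositive_kraus _

theorem isCompletelyPositive_one : IsCompletelyPositive (1 : SuperOp n) := by
  have : (1 : SuperOp n) = kraus fun _ : Unit => (1 : Op n) := by
    ext1 A
    simp [kraus_apply]
  rw [this]
  exact isCompletelyPositive_kraus _

theorem IsCompletelyPositive.pow {T : SuperOp n} (hT : IsCompletelyPositive T) (k : ℕ) :
    IsCompletelyPositive (T ^ k) := by
  induction k with
  | zero => exact isCompletelyPositive_one
  | succ k ih => exact pow_succ T k ▸ ih.mul hT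

theorem continuous_choi : Continuous (choi : SuperOp n → Matrix (n × n) (n × n) ℂ) := by
  let c : SuperOp n →ₗ[ℂ] Matrix (n × n) (n × n) ℂ :=
    { toFun := choi
      map_add' := fun S T => rfl
      map_smul' := fun a T => rfl }
  exact c.continuous_of_finiteDimensional

theorem isClosed_posSemidef (ι : Type*) [Fintype ι] [DecidableEq ι] :
    IsClosed {A : Matrix ι ι ℂ | A.PosSemidef} := by
  have : {A : Matrix ι ι ℂ | A.PosSemidef} = Set.Ici 0 := by
    ext A
    exact nonneg_iff_posSemidef.symm
  rw [this]
  exact isClosed_Ici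

/-- The Choi criterion makes complete positivity the preimage of a closed cone under a continuous
map; this carries it to the limit `τ → 0⁺`. -/
theorem isClosed_isCompletelyPositive : IsClosed {T : SuperOp n | IsCompletelyPositive T} := by
  have : {T : SuperOp n | IsCompletelyPositive T} = choi ⁻¹' {A | A.PosSemidef} := by
    ext T
    exact isCompletelyPositive_iff_posSemidef_choi
  rw [this]
  exact (isClosed_posSemidef _).preimage continuous_choi

end CompletelyPositive

end RepeatedInteraction

/-! ### Second-order expansions in `√τ` -/

section Expansion

open Asymptotics NormedSpace

theorem sqrt_tendsto_nhdsGT_zero : Tendsto (fun τ : ℝ => √τ) (𝓝[>] 0) (𝓝 0) := by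
  have := (Real.continuous_sqrt.tendsto 0).mono_left (nhdsWithin_le_nhds (s := Set.Ioi 0))
  rwa [Real.sqrt_zero] at this

theorem sqrt_isBigO_one : (fun τ : ℝ => √τ) =O[𝓝[>] 0] fun _ => (1 : ℝ) :=
  sqrt_tendsto_nhdsGT_zero.isBigO_one ℝ

theorem sqrt_mul_self_isLittleO : (fun τ : ℝ => √τ * τ) =o[𝓝[>] 0] fun τ => τ := by
  have h := (isLittleO_one_iff ℝ).2 sqrt_tendsto_nhdsGT_zero
  simpa using h.mul_isBigO (isBigO_refl (fun τ : ℝ => τ) (𝓝[>] 0))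

theorem self_isBigO_sqrt : (fun τ : ℝ => τ) =O[𝓝[>] 0] fun τ => √τ := by
  have h : (fun τ : ℝ => √τ * √τ) =O[𝓝[>] 0] fun τ => √τ * 1 :=
    (isBigO_refl _ _).mul sqrt_isBigO_one
  refine (h.congr' ?_ ?_)
  · filter_upwards [self_mem_nhdsWithin] with τ hτ using Real.mul_self_sqrt (le_of_lt hτ)
  · exact Eventually.of_forall fun τ => mul_one _

theorem isLittleO_smul_const {E : Type*} [NormedAddCommGroup E] [NormedSpace ℂ E]
    {l : Filter ℝ} {f g : ℝ → ℝ} (h : f =o[l] g) (x : E) :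
    (fun τ => ((f τ : ℝ) : ℂ) • x) =o[l] g := by
  have : (fun τ => ((f τ : ℝ) : ℂ) • x) =O[l] f :=
    IsBigO.of_bound ‖x‖ (Eventually.of_forall fun τ => by
      rw [norm_smul, Complex.norm_real, mul_comm])
  exact this.trans_isLittleO h

theorem isBigO_smul_const {E : Type*} [NormedAddCommGroup E] [NormedSpace ℂ E]
    {l : Filter ℝ} {f g : ℝ → ℝ} (h : f =O[l] g) (x : E) :
    (fun τ => ((f τ : ℝ) : ℂ) • x) =O[l] g := by
  have : (fun τ => ((f τ : ℝ) : ℂ) • x) =O[l] f :=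
    IsBigO.of_bound ‖x‖ (Eventually.of_forall fun τ => by
      rw [norm_smul, Complex.norm_real, mul_comm])
  exact this.trans h

theorem exp_sub_quadratic_isBigO {𝔸 : Type*} [NormedRing 𝔸] [NormedAlgebra ℂ 𝔸]
    [CompleteSpace 𝔸] :
    (fun x : 𝔸 => exp x - (1 + x + (1 / 2 : ℂ) • (x * x))) =O[𝓝 0] fun x => ‖x‖ ^ 3 := by
  have h := (exp_hasFPowerSeriesAt_zero (𝕂 := ℂ) (𝔸 := 𝔸)).isBigO_sub_partialSum_pow 3
  refine h.congr_left fun x => ?_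
  simp [FormalMultilinearSeries.partialSum, Finset.sum_range_succ, expSeries_apply_eq, pow_two]

/-- Second order expansion, in `√τ`, of `exp (√τ X + τ Y)`. -/
theorem exp_sqrt_smul_add_smul_isLittleO {𝔸 : Type*} [NormedRing 𝔸] [NormedAlgebra ℂ 𝔸]
    [CompleteSpace 𝔸] (X Y : 𝔸) :
    (fun τ : ℝ => exp (((√τ : ℝ) : ℂ) • X + (τ : ℂ) • Y) -
      (1 + ((√τ : ℝ) : ℂ) • X + (τ : ℂ) • (Y + (1 / 2 : ℂ) • (X * X))))
      =o[𝓝[>] 0] fun τ => τ := by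
  set Z : ℝ → 𝔸 := fun τ => ((√τ : ℝ) : ℂ) • X + (τ : ℂ) • Y with hZ
  have hZO : Z =O[𝓝[>] 0] fun τ : ℝ => √τ :=
    (isBigO_smul_const (isBigO_refl _ _) X).add (isBigO_smul_const self_isBigO_sqrt Y)
  have hZ0 : Tendsto Z (𝓝[>] 0) (𝓝 0) := hZO.trans_tendsto sqrt_tendsto_nhdsGT_zero
  have h1 : (fun τ => exp (Z τ) - (1 + Z τ + (1 / 2 : ℂ) • (Z τ * Z τ))) =o[𝓝[>] 0]
      fun τ : ℝ => τ := by
    have ha := (exp_sub_quadratic_isBigO (𝔸 := 𝔸)).comp_tendsto hZ0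
    have hb : (fun τ => ‖Z τ‖ ^ 3) =O[𝓝[>] 0] fun τ : ℝ => √τ ^ 3 := hZO.norm_left.pow 3
    refine (ha.trans hb).trans_isLittleO (sqrt_mul_self_isLittleO.congr' ?_ EventuallyEq.rfl)
    filter_upwards [self_mem_nhdsWithin] with τ hτ
    have := Real.mul_self_sqrt (le_of_lt hτ)
    linear_combination (-√τ) * this
  -- These are the terms of `½ (√τ X + τ Y)²` of order `τ^(3/2)` and `τ²`.
  have h2 : (fun τ : ℝ => (((√τ * τ : ℝ)) : ℂ) • ((1 / 2 : ℂ) • (X * Y + Y * X)) +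
      ((τ * τ : ℝ) : ℂ) • ((1 / 2 : ℂ) • (Y * Y))) =o[𝓝[>] 0] fun τ : ℝ => τ := by
    refine (isLittleO_smul_const sqrt_mul_self_isLittleO _).add (isLittleO_smul_const ?_ _)
    have h3 : (fun τ : ℝ => τ) =o[𝓝[>] 0] fun _ => (1 : ℝ) :=
      (isLittleO_one_iff ℝ).2 (tendsto_id.mono_left nhdsWithin_le_nhds)
    simpa using h3.mul_isBigO (isBigO_refl (fun τ : ℝ => τ) (𝓝[>] 0))
  refine (h1.add h2).congr' ?_ EventuallyEq.rfl
  filter_upwards [self_mem_nhdsWithin] with τ hτ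
  have e : ((√τ : ℝ) : ℂ) * ((√τ : ℝ) : ℂ) = (τ : ℂ) := by
    rw [← Complex.ofReal_mul, Real.mul_self_sqrt (le_of_lt hτ)]
  simp only [hZ, mul_add, add_mul, smul_mul_assoc, mul_smul_comm, smul_add, smul_smul,
    Complex.ofReal_mul]
  have e2 : (1 / 2 : ℂ) * (((√τ : ℝ) : ℂ) * ((√τ : ℝ) : ℂ)) = (τ : ℂ) * (1 / 2) := by rw [e]; ring
  rw [e2]
  module

/-- Second order expansion, in `√τ`, of a bilinear expression. -/
theorem bilinear_expansion_isLittleO {F G : Type*} [NormedAddCommGroup F] [NormedSpace ℂ F]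
    [NormedAddCommGroup G] [NormedSpace ℂ G] (B : F →L[ℂ] F →L[ℂ] G) {a b : ℝ → F}
    {a₀ a₁ a₂ b₀ b₁ b₂ : F}
    (ha : (fun τ : ℝ => a τ - (a₀ + ((√τ : ℝ) : ℂ) • a₁ + (τ : ℂ) • a₂)) =o[𝓝[>] 0] fun τ => τ)
    (hb : (fun τ : ℝ => b τ - (b₀ + ((√τ : ℝ) : ℂ) • b₁ + (τ : ℂ) • b₂)) =o[𝓝[>] 0] fun τ => τ) :
    (fun τ : ℝ => B (a τ) (b τ) - (B a₀ b₀ + ((√τ : ℝ) : ℂ) • (B a₀ b₁ + B a₁ b₀) +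
      (τ : ℂ) • (B a₀ b₂ + B a₁ b₁ + B a₂ b₀))) =o[𝓝[>] 0] fun τ => τ := by
  have hid : (fun τ : ℝ => τ) =o[𝓝[>] 0] fun _ => (1 : ℝ) :=
    (isLittleO_one_iff ℝ).2 (tendsto_id.mono_left nhdsWithin_le_nhds)
  have hbd : ∀ c₀ c₁ c₂ : F, (fun τ : ℝ => c₀ + ((√τ : ℝ) : ℂ) • c₁ + (τ : ℂ) • c₂)
      =O[𝓝[>] 0] fun _ => (1 : ℝ) := fun c₀ c₁ c₂ =>
    ((isBigO_const_const c₀ one_ne_zero _).add (isBigO_smul_const sqrt_isBigO_one c₁)).add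
      (isBigO_smul_const hid.isBigO c₂)
  have hB : ∀ {u v : ℝ → F}, (fun τ => B (u τ) (v τ)) =O[𝓝[>] 0] fun τ => ‖u τ‖ * ‖v τ‖ :=
    fun {u v} => IsBigO.of_bound ‖B‖ (Eventually.of_forall fun τ => by
      simpa [mul_assoc] using B.le_opNorm₂ (u τ) (v τ))
  have hb1 : b =O[𝓝[>] 0] fun _ => (1 : ℝ) :=
    ((hb.isBigO.trans hid.isBigO).add (hbd b₀ b₁ b₂)).congr_left fun τ => by abel
  -- `t1` and `t2` replace `a` and then `b` by their quadratic approximations; `t3` and `t4` are the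
  -- surplus terms of order `τ^(3/2)` and `τ²`.
  have t1 : (fun τ : ℝ => B (a τ - (a₀ + ((√τ : ℝ) : ℂ) • a₁ + (τ : ℂ) • a₂)) (b τ))
      =o[𝓝[>] 0] fun τ : ℝ => τ :=
    hB.trans_isLittleO (by simpa using ha.norm_left.mul_isBigO hb1.norm_left)
  have t2 : (fun τ : ℝ => B (a₀ + ((√τ : ℝ) : ℂ) • a₁ + (τ : ℂ) • a₂)
      (b τ - (b₀ + ((√τ : ℝ) : ℂ) • b₁ + (τ : ℂ) • b₂))) =o[𝓝[>] 0] fun τ : ℝ => τ :=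
    hB.trans_isLittleO (by simpa using (hbd a₀ a₁ a₂).norm_left.mul_isLittleO hb.norm_left)
  have t3 := isLittleO_smul_const sqrt_mul_self_isLittleO (B a₁ b₂ + B a₂ b₁)
  have t4 : (fun τ : ℝ => ((τ * τ : ℝ) : ℂ) • B a₂ b₂) =o[𝓝[>] 0] fun τ : ℝ => τ :=
    isLittleO_smul_const
      (by simpa using hid.mul_isBigO (isBigO_refl (fun τ : ℝ => τ) (𝓝[>] 0))) _
  refine (((t1.add t2).add t3).add t4).congr' ?_ EventuallyEq.rfl
  filter_upwards [self_mem_nhdsWithin] with τ hτ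
  have e : ((√τ : ℝ) : ℂ) * ((√τ : ℝ) : ℂ) = (τ : ℂ) := by
    rw [← Complex.ofReal_mul, Real.mul_self_sqrt (le_of_lt hτ)]
  simp only [map_add, map_sub, map_smul, _root_.add_apply,
    _root_.sub_apply, _root_.smul_apply, smul_add, smul_smul,
    Complex.ofReal_mul, e]
  module

end Expansion

namespace RepeatedInteraction

/-! ### Partial traces and the Heisenberg picture -/

section PartialTrace

variable {n m : Type*} [Fintype n] [DecidableEq n] [Fintype m] [DecidableEq m]

theorem partialTrace_add {n m : Type*} [Fintype m] (X Y : Op (n × m)) :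
    partialTrace (X + Y) = partialTrace X + partialTrace Y := by
  ext i j
  simp [partialTrace, Finset.sum_add_distrib]

theorem partialTrace_smul {n m : Type*} [Fintype m] (c : ℂ) (X : Op (n × m)) :
    partialTrace (c • X) = c • partialTrace X := by
  ext i j
  simp [partialTrace, Finset.mul_sum]

theorem partialTrace_kronecker {n m : Type*} [Fintype m] (A : Op n) (σ : Op m) :
    partialTrace (A ⊗ₖ σ) = trace σ • A := by
  ext i j
  simp [partialTrace, Matrix.trace, ← Finset.mul_sum, mul_comm]

theorem partialTrace_mul_kronecker_one {n m : Type*} [Fintype n] [Fintype m]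
    [DecidableEq m] (X : Op (n × m)) (A : Op n) :
    partialTrace (X * (A ⊗ₖ (1 : Op m))) = partialTrace X * A := by
  ext i j
  simp only [partialTrace, of_apply, Matrix.mul_apply, Fintype.sum_prod_type, kroneckerMap_apply,
    Matrix.one_apply, mul_ite, mul_one, mul_zero, Finset.sum_ite_eq', Finset.mem_univ, if_true,
    Finset.sum_mul]
  exact Finset.sum_comm

theorem partialTrace_kronecker_one_mul {n m : Type*} [Fintype n] [Fintype m]
    [DecidableEq m] (X : Op (n × m)) (A : Op n) :
    partialTrace ((A ⊗ₖ (1 : Op m)) * X) = A * partialTrace X := by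
  ext i j
  simp only [partialTrace, of_apply, Matrix.mul_apply, Fintype.sum_prod_type, kroneckerMap_apply,
    Matrix.one_apply, mul_ite, mul_one, mul_zero, ite_mul, zero_mul, Finset.sum_ite_eq,
    Finset.mem_univ, if_true, Finset.mul_sum]
  exact Finset.sum_comm

/-- `Tr_B` is cyclic with respect to operators acting on the bath alone. -/
theorem partialTrace_mul_one_kronecker_comm {n m : Type*} [Fintype n] [DecidableEq n]
    [Fintype m] (X : Op (n × m)) (S : Op m) :
    partialTrace (X * ((1 : Op n) ⊗ₖ S)) = partialTrace (((1 : Op n) ⊗ₖ S) * X) := by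
  ext i j
  simp only [partialTrace, of_apply, Matrix.mul_apply, Fintype.sum_prod_type, kroneckerMap_apply,
    Matrix.one_apply, ite_mul, mul_ite, zero_mul, mul_zero, one_mul]
  simp only [Finset.sum_comm (s := (Finset.univ : Finset n)) (t := (Finset.univ : Finset m)),
    Finset.sum_ite_eq, Finset.sum_ite_eq', Finset.mem_univ, if_true]
  rw [Finset.sum_comm]
  simp only [mul_comm]

theorem trace_mul_partialTrace {n m : Type*} [Fintype n] [Fintype m] [DecidableEq m] (A : Op n) (X : Op (n × m)) :
    trace (A * partialTrace X) = trace ((A ⊗ₖ (1 : Op m)) * X) := by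
  rw [← partialTrace_kronecker_one_mul]
  simp [Matrix.trace, partialTrace, Fintype.sum_prod_type]

theorem sandwich_apply {n m : Type*} [Fintype n] [DecidableEq n] [Fintype m] (X Y : Op (n × m)) (σ : Op m) (ρ : Op n) :
    sandwich X Y σ ρ = partialTrace (X * (ρ ⊗ₖ σ) * Y) := rfl

/-- The slice map `Z ↦ Tr_B (Z (1 ⊗ σ))`. -/
noncomputable def slice (n : Type*) [Fintype n] [DecidableEq n] (σ : Op m) :
    Op (n × m) →L[ℂ] Op n :=
  LinearMap.toContinuousLinearMap
    { toFun := fun Z => partialTrace (Z * ((1 : Op n) ⊗ₖ σ))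
      map_add' := fun X Y => by rw [Matrix.add_mul, partialTrace_add]
      map_smul' := fun c X => by rw [Matrix.smul_mul, partialTrace_smul, RingHom.id_apply] }

theorem slice_apply {n m : Type*} [Fintype n] [DecidableEq n] [Fintype m] (σ : Op m) (Z : Op (n × m)) :
    slice n σ Z = partialTrace (Z * ((1 : Op n) ⊗ₖ σ)) := rfl

theorem one_kronecker_mul_kronecker_one (σ : Op m) (A : Op n) :
    ((1 : Op n) ⊗ₖ σ) * (A ⊗ₖ (1 : Op m)) = (A ⊗ₖ (1 : Op m)) * ((1 : Op n) ⊗ₖ σ) := by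
  rw [← mul_kronecker_mul, ← mul_kronecker_mul, one_mul, mul_one, one_mul, mul_one]

theorem slice_mul_kronecker_one (σ : Op m) (Z : Op (n × m)) (A : Op n) :
    slice n σ (Z * (A ⊗ₖ (1 : Op m))) = slice n σ Z * A := by
  rw [slice_apply, slice_apply, Matrix.mul_assoc, ← one_kronecker_mul_kronecker_one,
    ← Matrix.mul_assoc, partialTrace_mul_kronecker_one]

theorem slice_kronecker_one_mul (σ : Op m) (Z : Op (n × m)) (A : Op n) :
    slice n σ ((A ⊗ₖ (1 : Op m)) * Z) = A * slice n σ Z := by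
  rw [slice_apply, slice_apply, Matrix.mul_assoc, partialTrace_kronecker_one_mul]

theorem slice_one (σ : Op m) : slice n σ 1 = trace σ • (1 : Op n) := by
  rw [slice_apply, one_mul, partialTrace_kronecker]

/-- The ampliation `A ↦ A ⊗ 1`. -/
noncomputable def ampliation (n m : Type*) [Fintype n] [DecidableEq n] [Fintype m]
    [DecidableEq m] : Op n →L[ℂ] Op (n × m) :=
  LinearMap.toContinuousLinearMap
    { toFun := fun A => A ⊗ₖ (1 : Op m)
      map_add' := fun A B => add_kronecker A B 1
      map_smul' := fun c A => smul_kronecker c A 1 }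

/-- The bilinear map taking `(Y, X)` to `A ↦ Tr_B (Y (A ⊗ 1) X (1 ⊗ σ))`. -/
noncomputable def heisenberg (n : Type*) [Fintype n] [DecidableEq n] (σ : Op m) :
    Op (n × m) →L[ℂ] Op (n × m) →L[ℂ] SuperOp n :=
  ((ContinuousLinearMap.compL ℂ (Op (n × m)) (Op (n × m) →L[ℂ] Op (n × m)) (SuperOp n))
    ((ContinuousLinearMap.compL ℂ (Op n) (Op (n × m)) (Op n) (slice n σ)).comp
      ((ContinuousLinearMap.compL ℂ (Op n) (Op (n × m)) (Op (n × m))).flip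
        (ampliation n m)))).comp
    (ContinuousLinearMap.mulLeftRight ℂ (Op (n × m)))

theorem heisenberg_apply (σ : Op m) (X Y : Op (n × m)) (A : Op n) :
    heisenberg n σ Y X A = slice n σ (Y * (A ⊗ₖ (1 : Op m)) * X) := rfl

theorem dual_sandwich (σ : Op m) (X Y : Op (n × m)) :
    dual (sandwich X Y σ) = heisenberg n σ Y X := by
  symm
  apply eq_dual_of_trace
  intro A ρ
  have e : A ⊗ₖ σ = ((1 : Op n) ⊗ₖ σ) * (A ⊗ₖ (1 : Op m)) := by
    rw [← mul_kronecker_mul, one_mul, mul_one]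
  rw [heisenberg_apply, slice_apply, trace_mul_partialTrace, trace_mul_comm _ ρ, sandwich_apply,
    trace_mul_partialTrace, e, trace_mul_comm]
  simp only [Matrix.mul_assoc]
  rw [trace_mul_comm (ρ ⊗ₖ (1 : Op m))]
  simp only [Matrix.mul_assoc]
  rw [← Matrix.mul_assoc Y, trace_mul_comm (Y * _)]
  simp only [Matrix.mul_assoc]

/-- The Kraus operators are the blocks of `W`, indexed by pairs of bath basis vectors. -/
theorem isCompletelyPositive_partialTrace_conj {T : SuperOp n} (W : Op (n × m))
    (hT : ∀ A, T A = partialTrace (Wᴴ * (A ⊗ₖ (1 : Op m)) * W)) : IsCompletelyPositive T := by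
  have : T = kraus fun p : m × m => Matrix.of fun i j => W (i, p.1) (j, p.2) := by
    ext A i j
    rw [hT, kraus_apply, Matrix.sum_apply, Fintype.sum_prod_type]
    simp only [partialTrace, of_apply, Matrix.mul_apply, Fintype.sum_prod_type,
      kroneckerMap_apply, Matrix.one_apply, mul_ite, mul_one, mul_zero, conjTranspose_apply,
      Finset.sum_ite_eq', Finset.mem_univ, if_true]
    rw [Finset.sum_comm]
    rw [Finset.sum_comm (s := (Finset.univ : Finset m)) (t := (Finset.univ : Finset m))]
    rw [Finset.sum_comm]
    refine Finset.sum_congr rfl fun x _ => ?_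
    rw [Finset.sum_comm]
  rw [this]
  exact isCompletelyPositive_kraus _

/-- Write `σ = S S^*` and move `1 ⊗ S^*` to the front by partial cyclicity: the map becomes
conjugation by `X (1 ⊗ S)` followed by `Tr_B`. -/
theorem isCompletelyPositive_heisenberg {σ : Op m} (hσ : σ.PosSemidef) (X : Op (n × m)) :
    IsCompletelyPositive (heisenberg n σ Xᴴ X) := by
  obtain ⟨S, hS⟩ := CStarAlgebra.nonneg_iff_eq_mul_star_self.1 hσ.nonneg
  refine isCompletelyPositive_partialTrace_conj (X * ((1 : Op n) ⊗ₖ S)) fun A => ?_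
  have e : (1 : Op n) ⊗ₖ σ = ((1 : Op n) ⊗ₖ S) * ((1 : Op n) ⊗ₖ Sᴴ) := by
    rw [← mul_kronecker_mul, one_mul, hS, star_eq_conjTranspose]
  rw [heisenberg_apply, slice_apply, e, ← Matrix.mul_assoc, partialTrace_mul_one_kronecker_comm,
    conjTranspose_mul, conjTranspose_kronecker, conjTranspose_one]
  simp only [Matrix.mul_assoc]

end PartialTrace

/-! ### One interaction step to first order in `τ` -/

namespace Model

open Asymptotics

variable {n m : Type*} [Fintype n] [DecidableEq n] [Fintype m] [DecidableEq m] (M : Model n m)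

theorem step_eq_heisenberg (τ : ℝ) :
    M.step τ = heisenberg n M.rhoB (M.U τ)ᴴ (M.U τ) := dual_sandwich _ _ _

theorem Phi_eq_heisenberg : M.Phi = heisenberg n M.rhoB M.HSB M.HSB := dual_sandwich _ _ _

theorem isCompletelyPositive_Phi : IsCompletelyPositive M.Phi := by
  have h := isCompletelyPositive_heisenberg (n := n) M.posSemidef_rhoB M.HSB
  rwa [M.isHermitian_HSB.eq, ← Phi_eq_heisenberg] at h

theorem isCompletelyPositive_step (τ : ℝ) : IsCompletelyPositive (M.step τ) := by
  rw [step_eq_heisenberg]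
  exact isCompletelyPositive_heisenberg M.posSemidef_rhoB _

theorem isHermitian_HS_kronecker_one : (M.HS ⊗ₖ (1 : Op m)).IsHermitian := by
  rw [IsHermitian, conjTranspose_kronecker, M.isHermitian_HS.eq, conjTranspose_one]

theorem conjTranspose_U_mul_U (τ : ℝ) : (M.U τ)ᴴ * M.U τ = 1 := by
  have hskew : (-(Complex.I * (τ : ℂ)) • (M.HS ⊗ₖ (1 : Op m)) -
      (Complex.I * ((√τ : ℝ) : ℂ)) • M.HSB) ∈ skewAdjoint (Op (n × m)) := by
    rw [skewAdjoint.mem_iff, star_eq_conjTranspose, conjTranspose_sub, conjTranspose_smul,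
      conjTranspose_smul, M.isHermitian_HSB.eq, M.isHermitian_HS_kronecker_one.eq]
    simp only [star_neg, star_mul, RCLike.star_def, Complex.conj_I, Complex.conj_ofReal]
    module
  let _ : NormedAlgebra ℚ (Op (n × m)) := NormedAlgebra.restrictScalars ℚ ℂ _
  have := NormedSpace.exp_mem_unitary_of_mem_skewAdjoint hskew
  exact (Unitary.mem_iff.1 this).1

theorem step_one (τ : ℝ) : M.step τ 1 = 1 := by
  rw [step_eq_heisenberg, heisenberg_apply, one_kronecker_one, mul_one, conjTranspose_U_mul_U,
    slice_one, M.trace_rhoB, one_smul]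

theorem U_expansion : (fun τ : ℝ => M.U τ - (1 + ((√τ : ℝ) : ℂ) • (-Complex.I • M.HSB) +
      (τ : ℂ) • (-Complex.I • (M.HS ⊗ₖ (1 : Op m)) - (1 / 2 : ℂ) • (M.HSB * M.HSB))))
      =o[𝓝[>] 0] fun τ => τ := by
  have h := exp_sqrt_smul_add_smul_isLittleO (-Complex.I • M.HSB)
    (-Complex.I • (M.HS ⊗ₖ (1 : Op m)))
  refine h.congr_left fun τ => ?_
  congr 1
  · rw [U]
    congr 1
    module
  · congr 2
    rw [smul_mul_smul_comm, neg_mul_neg, Complex.I_mul_I]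
    module

theorem conjTranspose_U_expansion :
    (fun τ : ℝ => (M.U τ)ᴴ - (1 + ((√τ : ℝ) : ℂ) • (Complex.I • M.HSB) +
      (τ : ℂ) • (Complex.I • (M.HS ⊗ₖ (1 : Op m)) - (1 / 2 : ℂ) • (M.HSB * M.HSB))))
      =o[𝓝[>] 0] fun τ => τ := by
  refine IsLittleO.of_norm_left (M.U_expansion.norm_left.congr_left fun τ => ?_)
  rw [← l2_opNorm_conjTranspose]
  congr 1
  simp only [conjTranspose_sub, conjTranspose_add, conjTranspose_smul, conjTranspose_mul,
    conjTranspose_one, M.isHermitian_HSB.eq, M.isHermitian_HS_kronecker_one.eq, star_neg,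
    RCLike.star_def, Complex.conj_I, Complex.conj_ofReal, neg_neg, map_div₀, map_one, map_ofNat]

theorem slice_HSB : slice n M.rhoB M.HSB = 0 := M.centered

/-- First order expansion of the evolution over one interaction. -/
theorem step_expansion :
    (fun τ : ℝ => M.step τ - 1 - τ • lindbladian M.HS M.Phi) =o[𝓝[>] 0] fun τ => τ := by
  have h := bilinear_expansion_isLittleO (F := Op (n × m)) (G := SuperOp n) (heisenberg n M.rhoB) M.conjTranspose_U_expansion
    M.U_expansion
  refine h.congr_left fun τ => ?_
  have e0 : heisenberg n M.rhoB 1 1 = 1 := by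
    ext1 A
    rw [heisenberg_apply, one_mul, mul_one, ← mul_one (A ⊗ₖ (1 : Op m)), slice_kronecker_one_mul,
      slice_one, M.trace_rhoB, one_smul, mul_one, one_apply_eq_self]
  have hl : ∀ (X : Op (n × m)) A, heisenberg n M.rhoB X 1 A = slice n M.rhoB X * A :=
    fun X A => by rw [heisenberg_apply, mul_one, slice_mul_kronecker_one]
  have hr : ∀ (X : Op (n × m)) A, heisenberg n M.rhoB 1 X A = A * slice n M.rhoB X :=
    fun X A => by rw [heisenberg_apply, one_mul, slice_kronecker_one_mul]
  have hHS : slice n M.rhoB (M.HS ⊗ₖ (1 : Op m)) = M.HS := by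
    have := slice_mul_kronecker_one M.rhoB 1 M.HS
    rwa [one_mul, slice_one, M.trace_rhoB, one_smul, one_mul] at this
  have hPhi1 : slice n M.rhoB (M.HSB * M.HSB) = M.Phi 1 := by
    rw [Phi_eq_heisenberg, heisenberg_apply, one_kronecker_one, mul_one]
  -- The order `√τ` term involves only the slice of `H_SB`, which is zero by centering.
  have e1 : heisenberg n M.rhoB 1 (-Complex.I • M.HSB) +
      heisenberg n M.rhoB (Complex.I • M.HSB) 1 = 0 := by
    ext1 A
    rw [_root_.add_apply, hl, hr, map_smul, map_smul, slice_HSB]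
    simp
  -- The mixed term is `Φ` because `i · (-i) = 1`; the outer terms give the commutator and, as
  -- `H_SB²` slices to `Φ 1`, the anticommutator.
  have e2 : heisenberg n M.rhoB 1
        (-Complex.I • (M.HS ⊗ₖ (1 : Op m)) - (1 / 2 : ℂ) • (M.HSB * M.HSB)) +
      heisenberg n M.rhoB (Complex.I • M.HSB) (-Complex.I • M.HSB) +
      heisenberg n M.rhoB
        (Complex.I • (M.HS ⊗ₖ (1 : Op m)) - (1 / 2 : ℂ) • (M.HSB * M.HSB)) 1 =
      lindbladian M.HS M.Phi := by
    ext1 A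
    have e3 : heisenberg n M.rhoB (Complex.I • M.HSB) (-Complex.I • M.HSB) = M.Phi := by
      rw [Phi_eq_heisenberg, map_smul, map_smul, _root_.smul_apply, smul_smul]
      simp
    have e4 : lindbladian M.HS M.Phi A = Complex.I • (M.HS * A - A * M.HS) + M.Phi A -
      (1 / 2 : ℂ) • (M.Phi 1 * A + A * M.Phi 1) := rfl
    rw [_root_.add_apply, _root_.add_apply, hl, hr, e3, e4]
    simp only [map_sub, map_smul, hHS, hPhi1, Matrix.mul_sub, Matrix.sub_mul, Matrix.mul_smul,
      Matrix.smul_mul]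
    module
  rw [e0, e1, e2, ← step_eq_heisenberg, smul_zero, add_zero, Complex.coe_smul, sub_sub]

end Model

/-! ### The limit semigroup, and models with prescribed Kraus operators -/

section Generator

open NormedSpace

variable {n : Type*} [Fintype n] [DecidableEq n]

theorem isGenerator_exp (L : SuperOp n) : IsGenerator (fun t : ℝ≥0 => exp ((t : ℝ) • L)) L := by
  have h := tendsto_inv_smul_exp_smul_sub_one L
  have h2 : Tendsto (fun t : ℝ≥0 => (t : ℝ)) (𝓝[>] 0) (𝓝[>] 0) := by
    refine tendsto_nhdsWithin_iff.2 ⟨?_, ?_⟩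
    · exact (NNReal.continuous_coe.tendsto 0).mono_left nhdsWithin_le_nhds
    · filter_upwards [self_mem_nhdsWithin] with t ht
      exact NNReal.coe_pos.2 ht
  refine (h.comp h2).congr fun t => ?_
  simp only [Function.comp]
  rw [← Complex.coe_smul, Complex.ofReal_inv]

theorem norm_superOp_one_le : ‖(1 : SuperOp n)‖ ≤ 1 := ContinuousLinearMap.norm_id_le

end Generator

namespace Model

open NormedSpace

variable {n m : Type*} [Fintype n] [DecidableEq n] [Fintype m] [DecidableEq m] (M : Model n m)

theorem eventually_norm_step_pow_sub_exp_le (T ε : ℝ) (hε : 0 < ε) :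
    ∀ᶠ τ : ℝ in 𝓝[>] 0, ∀ t : ℝ≥0, (t : ℝ) ≤ T →
      ‖M.step τ ^ ⌊(t : ℝ) / τ⌋₊ - exp ((t : ℝ) • lindbladian M.HS M.Phi)‖ ≤ ε := by
  filter_upwards [eventually_norm_pow_floor_sub_exp_le norm_superOp_one_le M.step _
    M.step_expansion T ε hε] with τ hτ t ht using hτ t t.2 ht

theorem convergesTo_exp :
    M.ConvergesTo fun t => exp ((t : ℝ) • lindbladian M.HS M.Phi) :=
  M.convergesTo_of_norm _ M.eventually_norm_step_pow_sub_exp_le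

theorem tendsto_step_pow (t : ℝ≥0) :
    Tendsto (fun τ : ℝ => M.step τ ^ ⌊(t : ℝ) / τ⌋₊) (𝓝[>] 0)
      (𝓝 (exp ((t : ℝ) • lindbladian M.HS M.Phi))) := by
  refine Metric.nhds_basis_closedBall.tendsto_right_iff.2 fun ε hε => ?_
  filter_upwards [M.eventually_norm_step_pow_sub_exp_le t ε hε] with τ hτ
  rw [Metric.mem_closedBall, dist_eq_norm]
  exact hτ t le_rfl

theorem step_pow_one (τ : ℝ) (k : ℕ) : (M.step τ ^ k) 1 = 1 := by
  induction k with
  | zero => rfl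
  | succ k ih => rw [pow_succ, mul_apply_eq_comp, step_one, ih]

/-- Complete positivity and unitality are inherited from the discrete evolutions `Λ_τ ^ k`, with no
algebra on the Lindbladian itself. -/
theorem isQMS_exp : IsQMS fun t => exp ((t : ℝ) • lindbladian M.HS M.Phi) where
  completelyPositive t := isClosed_isCompletelyPositive.mem_of_tendsto (M.tendsto_step_pow t)
    (Eventually.of_forall fun τ => (M.isCompletelyPositive_step τ).pow _)
  map_one t := by
    have h : Tendsto (fun τ : ℝ => (M.step τ ^ ⌊(t : ℝ) / τ⌋₊) 1) (𝓝[>] 0)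
        (𝓝 (exp ((t : ℝ) • lindbladian M.HS M.Phi) 1)) :=
      ((ContinuousLinearMap.apply ℂ (Op n) (1 : Op n)).continuous.tendsto _).comp
        (M.tendsto_step_pow t)
    simp only [step_pow_one] at h
    exact tendsto_nhds_unique h tendsto_const_nhds
  zero := exp_zero_smul (lindbladian M.HS M.Phi)
  add s t := by
    rw [NNReal.coe_add]
    exact exp_add_smul (lindbladian M.HS M.Phi) (s : ℝ) t
  continuous := (continuous_exp_smul (lindbladian M.HS M.Phi)).comp NNReal.continuous_coe

/-- The model with interaction `∑ a, V a ⊗ |a⟩⟨e| + h.c.` and bath state `|e⟩⟨e|`. -/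
noncomputable def ofKraus (H : Op n) (hH : H.IsHermitian) (e : m) (V : m → Op n) (hV : V e = 0) :
    Model n m where
  HS := H
  HSB := Matrix.of fun p q =>
    (if q.2 = e then V p.2 p.1 q.1 else 0) + if p.2 = e then star (V q.2 q.1 p.1) else 0
  rhoB := Matrix.single e e 1
  isHermitian_HS := hH
  isHermitian_HSB := by
    ext p q
    simp only [conjTranspose_apply, of_apply, star_add, apply_ite star, star_star, star_zero]
    exact add_comm _ _
  posSemidef_rhoB := by
    have : (Matrix.single e e 1 : Op m) = (Matrix.single e e 1)ᴴ * Matrix.single e e 1 := by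
      simp
    rw [this]
    exact posSemidef_conjTranspose_mul_self _
  trace_rhoB := trace_single_eq_same e 1
  -- The state `|e⟩⟨e|` selects the `(e, e)` block of the interaction, `V e + (V e)^* = 0`.
  centered := by
    ext i j
    simp [partialTrace, Matrix.mul_apply, Fintype.sum_prod_type, Matrix.single_apply,
      Matrix.one_apply, ite_and, hV]

theorem slice_single (e : m) (Z : Op (n × m)) (i j : n) :
    slice n (Matrix.single e e 1) Z i j = Z (i, e) (j, e) := by
  simp [slice_apply, partialTrace, Matrix.mul_apply, Fintype.sum_prod_type, Matrix.single_apply,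
      Matrix.one_apply, ite_and]

/-- Only the `(e, e)` block of `H_SB (A ⊗ 1) H_SB` survives, and column `e` of `H_SB` consists of
the `V a`. At `a = e` both defining terms overlap, harmlessly since `V e = 0`. -/
theorem Phi_ofKraus (H : Op n) (hH : H.IsHermitian) (e : m) (V : m → Op n) (hV : V e = 0) :
    (ofKraus H hH e V hV).Phi = kraus V := by
  ext A i j
  have h1 : ∀ l a j, (ofKraus H hH e V hV).HSB (l, a) (j, e) = V a l j := fun l a j => by
    by_cases ha : a = e <;> simp [ofKraus, ha, hV]
  have h2 : ∀ l a j, (ofKraus H hH e V hV).HSB (j, e) (l, a) = star (V a l j) := fun l a j => by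
    by_cases ha : a = e <;> simp [ofKraus, ha, hV]
  rw [Phi_eq_heisenberg, heisenberg_apply]
  change slice n (Matrix.single e e 1) _ i j = _
  rw [slice_single, kraus_apply, Matrix.sum_apply]
  simp only [Matrix.mul_apply, Fintype.sum_prod_type, h1, h2, kroneckerMap_apply,
    Matrix.one_apply, mul_ite, mul_one, mul_zero, conjTranspose_apply, Finset.sum_ite_eq',
    Finset.mem_univ, if_true]
  exact Finset.sum_comm

end Model

/-! ### Lindblad form of the generator and the converse -/

section Lindblad

open NormedSpace

variable {n : Type*} [Fintype n] [DecidableEq n]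

/-- The (unnormalized) maximally entangled vector. -/
def entangled (n : Type*) [DecidableEq n] : n × n → ℂ := fun p => if p.1 = p.2 then 1 else 0

theorem star_entangled (n : Type*) [DecidableEq n] : star (entangled n) = entangled n := by
  ext p
  simp [entangled, apply_ite]

theorem entangled_dotProduct_self : entangled n ⬝ᵥ entangled n = (Fintype.card n : ℂ) := by
  simp [dotProduct, entangled, Fintype.sum_prod_type]

theorem choi_one : choi (1 : SuperOp n) = vecMulVec (entangled n) (entangled n) := by
  ext ⟨i, k⟩ ⟨j, l⟩
  simp [choi_apply, vecMulVec_apply, entangled, Matrix.single_apply, ← ite_and, and_comm]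

/-- The orthogonal projection onto the complement of the maximally entangled vector. -/
noncomputable def entangledCompl (n : Type*) [Fintype n] [DecidableEq n] :
    Matrix (n × n) (n × n) ℂ :=
  1 - (Fintype.card n : ℂ)⁻¹ • vecMulVec (entangled n) (entangled n)

theorem conjTranspose_entangledCompl : (entangledCompl n)ᴴ = entangledCompl n := by
  rw [entangledCompl, conjTranspose_sub, conjTranspose_one, conjTranspose_smul,
    conjTranspose_vecMulVec, star_entangled n, star_inv₀, star_natCast]

theorem entangledCompl_mulVec : entangledCompl n *ᵥ entangled n = 0 := by
  rcases isEmpty_or_nonempty n with h | h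
  · exact Subsingleton.elim _ _
  · rw [entangledCompl, sub_mulVec, one_mulVec, smul_mulVec, vecMulVec_mulVec,
      entangled_dotProduct_self]
    ext p
    have : (Fintype.card n : ℂ) ≠ 0 := by simp
    simp only [Pi.sub_apply, Pi.smul_apply, Pi.zero_apply, MulOpposite.smul_eq_mul_unop,
      MulOpposite.unop_op, smul_eq_mul]
    field_simp
    ring

/-- A Hermitian matrix differs from its compression to the complement of the maximally entangled
vector by a rank-two term. -/
theorem exists_sub_compression_eq {C : Matrix (n × n) (n × n) ℂ} (hC : C.IsHermitian) :
    ∃ u : n × n → ℂ, C - entangledCompl n * C * entangledCompl n =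
      vecMulVec u (entangled n) + vecMulVec (entangled n) (star u) := by
  set Ω := entangled n
  set d : ℂ := (Fintype.card n : ℂ)⁻¹ with hd
  have hds : star d = d := by rw [hd, star_inv₀, star_natCast]
  set c : ℂ := Ω ⬝ᵥ C *ᵥ Ω with hc
  have hv : Ω ᵥ* C = star (C *ᵥ Ω) := by
    rw [star_mulVec, hC.eq, star_entangled n]
  have hcs : star c = c := by
    rw [hc, ← star_dotProduct_star, star_entangled n, ← hv, ← dotProduct_mulVec]
  have hQC : vecMulVec Ω Ω * C = vecMulVec Ω (star (C *ᵥ Ω)) := by rw [vecMulVec_mul, hv]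
  have hCQ : C * vecMulVec Ω Ω = vecMulVec (C *ᵥ Ω) Ω := mul_vecMulVec _ _ _
  have hQCQ : vecMulVec Ω (star (C *ᵥ Ω)) * vecMulVec Ω Ω = c • vecMulVec Ω Ω := by
    rw [← hv, vecMulVec_mul_vecMulVec, ← dotProduct_mulVec, vecMulVec_smul]
  -- The term `d² c` on the projector `ΩΩ^*` is split equally between `u` and `star u`, which is
  -- possible because `c` and `d` are real.
  refine ⟨d • C *ᵥ Ω - (d * d * c / 2) • Ω, ?_⟩
  have hdef : entangledCompl n = 1 - d • vecMulVec Ω Ω := rfl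
  rw [star_sub, star_smul, star_smul, star_entangled n, hds, star_div₀, star_mul, star_mul, hds, hcs,
    star_ofNat, hdef]
  simp only [Matrix.sub_mul, Matrix.mul_sub, one_mul, mul_one, Matrix.smul_mul, Matrix.mul_smul,
    hQC, hQCQ, hCQ, sub_vecMulVec, vecMulVec_sub, smul_vecMulVec,
    vecMulVec_smul]
  module

/-- The compressed Choi matrix supplies the Kraus part. The rank-two remainder is the Choi matrix of
`A ↦ K^* A + A K`, with `K` the conjugate of `u` reshaped into a matrix. -/
theorem exists_eq_kraus_add {L : SuperOp n} (hL : (choi L).IsHermitian)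
    (hP : (entangledCompl n * choi L * entangledCompl n).PosSemidef) :
    ∃ (V : n × n → Op n) (K : Op n), ∀ A, L A = kraus V A + Kᴴ * A + A * K := by
  obtain ⟨V, hV⟩ := exists_choi_kraus_eq hP
  obtain ⟨u, hu⟩ := exists_sub_compression_eq hL
  refine ⟨V, Matrix.of fun j l => star (u (j, l)), fun A => ?_⟩
  set K : Op n := Matrix.of fun j l => star (u (j, l)) with hK
  let R : SuperOp n := LinearMap.toContinuousLinearMap
    { toFun := fun A => Kᴴ * A + A * K
      map_add' := fun A B => by simp only [Matrix.mul_add, Matrix.add_mul]; abel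
      map_smul' := fun c A => by simp }
  have hR : ∀ A, R A = Kᴴ * A + A * K := fun _ => rfl
  have h : L = kraus V + R := by
    apply choi_injective
    have h1 : choi (kraus V + R) = choi (kraus V) + choi R := rfl
    rw [h1, hV, ← sub_eq_iff_eq_add', hu]
    ext ⟨i, k⟩ ⟨j, l⟩
    rw [choi_apply, hR]
    simp [vecMulVec_apply, entangled, Matrix.mul_apply, Matrix.single_apply, hK, ite_and]
  rw [h, _root_.add_apply, hR, add_assoc]

/-- A super-operator that annihilates `1` and whose Choi matrix is conditionally positive is of
Lindblad form. -/
theorem exists_eq_lindbladian {L : SuperOp n} (hL : (choi L).IsHermitian)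
    (hP : (entangledCompl n * choi L * entangledCompl n).PosSemidef) (hL1 : L 1 = 0) :
    ∃ (V : n × n → Op n) (H : Op n), H.IsHermitian ∧ L = lindbladian H (kraus V) := by
  obtain ⟨V, K, h⟩ := exists_eq_kraus_add hL hP
  -- The skew-Hermitian part of `K` yields the Hamiltonian; the Hermitian part is `-½ Φ 1`, forced
  -- by `L 1 = 0`.
  refine ⟨V, (Complex.I / 2) • (K - Kᴴ), ?_, ?_⟩
  · rw [IsHermitian, conjTranspose_smul, conjTranspose_sub, conjTranspose_conjTranspose,
      ← neg_sub, smul_neg, ← neg_smul]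
    congr 1
    simp
    ring
  · have h1 : kraus V 1 = -(Kᴴ + K) := by
      have := h 1
      rw [hL1, mul_one, one_mul, add_assoc] at this
      exact eq_neg_of_add_eq_zero_left this.symm
    ext1 A
    have e : lindbladian ((Complex.I / 2) • (K - Kᴴ)) (kraus V) A =
      Complex.I • (((Complex.I / 2) • (K - Kᴴ)) * A - A * ((Complex.I / 2) • (K - Kᴴ))) +
        kraus V A - (1 / 2 : ℂ) • (kraus V 1 * A + A * kraus V 1) := rfl
    have hI : Complex.I * (Complex.I / 2) = -(1 / 2) := by
      rw [← mul_div_assoc, Complex.I_mul_I]; norm_num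
    rw [e, h, h1]
    simp only [Matrix.smul_mul, Matrix.mul_smul, smul_sub, smul_smul, hI, Matrix.sub_mul,
      Matrix.mul_sub, Matrix.neg_mul, Matrix.mul_neg, Matrix.add_mul, Matrix.mul_add]
    module

theorem IsQMS.exists_eq_exp {Λ : ℝ≥0 → SuperOp n} (hΛ : IsQMS Λ) :
    ∃ L : SuperOp n, Λ = fun t : ℝ≥0 => exp ((t : ℝ) • L) := by
  obtain ⟨L, hL⟩ := exists_eq_exp_of_continuous_semigroup Λ hΛ.continuous hΛ.zero hΛ.add
  exact ⟨L, funext hL⟩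

theorem IsQMS.generator_one {Λ : ℝ≥0 → SuperOp n} {L : SuperOp n} (hΛ : IsQMS Λ)
    (hL : IsGenerator Λ L) : L 1 = 0 := by
  have h := ((ContinuousLinearMap.apply ℂ (Op n) (1 : Op n)).continuous.tendsto _).comp hL
  refine tendsto_nhds_unique h (tendsto_const_nhds.congr fun t => ?_)
  simp [hΛ.map_one]

theorem IsQMS.isHermitian_choi_generator {Λ : ℝ≥0 → SuperOp n} {L : SuperOp n} (hΛ : IsQMS Λ)
    (hL : IsGenerator Λ L) : (choi L).IsHermitian := by
  have hcl : IsClosed {T : SuperOp n | (choi T).IsHermitian} :=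
    isClosed_eq continuous_choi.matrix_conjTranspose continuous_choi
  refine hcl.mem_of_tendsto hL (Eventually.of_forall fun t => ?_)
  change ((((t : ℝ)⁻¹ : ℂ)) • (choi (Λ t) - choi 1)).IsHermitian
  have h1 := (hΛ.completelyPositive t).posSemidef_choi.isHermitian.sub
    (isCompletelyPositive_one (n := n)).posSemidef_choi.isHermitian
  rw [IsHermitian, conjTranspose_smul, h1.eq]
  congr 1
  simp

/-- Compression annihilates the Choi matrix of the identity, so the difference quotients compress to
`t⁻¹` times positive matrices, and positivity is closed. -/
theorem IsQMS.posSemidef_compression_generator {Λ : ℝ≥0 → SuperOp n} {L : SuperOp n}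
    (hΛ : IsQMS Λ) (hL : IsGenerator Λ L) :
    (entangledCompl n * choi L * entangledCompl n).PosSemidef := by
  have hcl : IsClosed {T : SuperOp n | (entangledCompl n * choi T * entangledCompl n).PosSemidef} :=
    (isClosed_posSemidef _).preimage
      ((continuous_const.mul continuous_choi).mul continuous_const)
  refine hcl.mem_of_tendsto hL (Eventually.of_forall fun t => ?_)
  change (entangledCompl n * ((((t : ℝ)⁻¹ : ℂ)) • (choi (Λ t) - choi 1)) *
    entangledCompl n).PosSemidef
  have h0 : entangledCompl n * choi 1 * entangledCompl n = 0 := by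
    rw [choi_one, mul_vecMulVec, entangledCompl_mulVec, zero_vecMulVec, zero_mul]
  rw [Matrix.mul_smul, Matrix.smul_mul, Matrix.mul_sub, Matrix.sub_mul, h0, sub_zero]
  refine PosSemidef.smul ?_ ?_
  · have := (hΛ.completelyPositive t).posSemidef_choi.mul_mul_conjTranspose_same (entangledCompl n)
    rwa [conjTranspose_entangledCompl] at this
  · rw [← Complex.ofReal_inv, Complex.zero_le_real]
    positivity

/-- Every quantum Markov semigroup is the limit of a repeated interaction model. -/
theorem IsQMS.exists_model {Λ : ℝ≥0 → SuperOp n} (hΛ : IsQMS Λ) :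
    ∃ (k : ℕ) (M : Model n (Fin k)), Λ = fun t : ℝ≥0 => exp ((t : ℝ) • lindbladian M.HS M.Phi) := by
  obtain ⟨L, rfl⟩ := hΛ.exists_eq_exp
  have hL := isGenerator_exp L
  obtain ⟨V, H, hH, h⟩ := exists_eq_lindbladian (hΛ.isHermitian_choi_generator hL)
    (hΛ.posSemidef_compression_generator hL) (hΛ.generator_one hL)
  let e := Fintype.equivFin (n × n)
  -- An extra bath level `0` with zero Kraus operator serves as the reference state `e`, so no given
  -- Kraus operator has to vanish.
  let V' : Fin (Fintype.card (n × n) + 1) → Op n := Fin.cons 0 fun p => V (e.symm p)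
  have hV : kraus V' = kraus V := by
    ext1 A
    rw [kraus_apply, kraus_apply, Fin.sum_univ_succ]
    simp only [V', Fin.cons_zero, Fin.cons_succ, mul_zero, zero_add]
    exact e.symm.sum_comp fun p => (V p)ᴴ * A * V p
  have h0 : V' 0 = 0 := rfl
  refine ⟨_, Model.ofKraus H hH 0 V' h0, ?_⟩
  have hM : lindbladian (Model.ofKraus H hH 0 V' h0).HS (Model.ofKraus H hH 0 V' h0).Phi = L := by
    rw [Model.Phi_ofKraus, hV, h]
    rfl
  rw [hM]

end Lindblad

end RepeatedInteraction

theorem mainTheorem7 {n : Type*} [Fintype n] [DecidableEq n] :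
    (∀ {m : Type*} [Fintype m] [DecidableEq m] (M : RepeatedInteraction.Model n m),
      RepeatedInteraction.IsCompletelyPositive M.Phi ∧
      ∃ Λ : ℝ≥0 → RepeatedInteraction.SuperOp n,
        RepeatedInteraction.IsQMS Λ ∧
        M.ConvergesTo Λ ∧
        RepeatedInteraction.IsGenerator Λ (RepeatedInteraction.lindbladian M.HS M.Phi)) ∧
    (∀ Λ : ℝ≥0 → RepeatedInteraction.SuperOp n, RepeatedInteraction.IsQMS Λ →
      ∃ (k : ℕ) (M : RepeatedInteraction.Model n (Fin k)),
        M.ConvergesTo Λ ∧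
        RepeatedInteraction.IsGenerator Λ (RepeatedInteraction.lindbladian M.HS M.Phi)) := by
  refine ⟨fun M => ⟨M.isCompletelyPositive_Phi, _, M.isQMS_exp, M.convergesTo_exp,
    RepeatedInteraction.isGenerator_exp _⟩, fun Λ hΛ => ?_⟩
  obtain ⟨k, M, rfl⟩ := hΛ.exists_model
  exact ⟨k, M, M.convergesTo_exp, RepeatedInteraction.isGenerator_exp _⟩
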